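/- Let $q\ge 1$, let $\Theta\subset\mathbb R^q$ be open, bounded and convex with closure $\Theta^c$, let $Y\subset\mathbb R^q$ be compact and let $y:[0,\infty)\to Y$ be continuous. Consider the regression model $$X(t)=a(t,\theta)+\varepsilon(t),\quad t\ge 0,\qquad a(t,\tau)=\exp\langle\tau,y(t)\rangle,\qquad \theta\in\Theta .$$ Assumptions. * (N1) $\varepsilon=\{\varepsilon(t),\,t\in\mathbb R\}$ is a stochastic process on a probability space $(\Omega,\mathfrak F,P)$ which is mean-square continuous and almost surely continuous, with $E\varepsilon(t)=0$ for all $t$. * (N4(i)) For every $t$, $\varepsilon(t)=\int_{-\infty}^{t}\psi(t-s)\,d\xi(s)$ as a mean-square Stieltjes integral (the $L^2(P)$-limit of the elementary integrals of simple functions converging in $L^2(\mathbb R)$ to the integrand). Here $\psi\in L^2(\mathbb R)$ is real, $\psi(t)=0$ for $t<0$. The process $\xi=\{\xi(t),\,t\in\mathbb R\}$ is mean-square continuous, has $E\xi(t)=0$, orthogonal increments, and $E|\xi(t+s)-\xi(t)|^2=s$ for $t\in\mathbb R$, $s>0$. It is jointly strictly sub-Gaussian: $E\exp\{\sum_i\Delta_i\xi(t_i)\}\le\exp\{\frac12\sum_{i,j}E[\xi(t_i)\xi(t_j)]\Delta_i\Delta_j\}$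 for all $n$, all $t_1,\dots,t_n\in\mathbb R$ and all $\Delta\in\mathbb R^n$. * (N4(ii)) $f_0=\operatorname{ess\,sup}_{\lambda\in\mathbb R}|h(i\lambda)|^2<\infty$, where $h(i\lambda)=(2\pi)^{-1/2}\int_0^\infty\psi(t)e^{-i\lambda t}\,dt$ is the Fourier–Plancherel transform of $\psi$. * The matrices $J_T=\bigl(T^{-1}\int_0^T y_i(t)y_j(t)\,dt\bigr)_{i,j=1}^q$ converge, as $T\to\infty$, to a positive definite matrix $J$, whose least eigenvalue is denoted by $\lambda_{\min}(J)$. Put $L=\min_{y\in Y,\ \tau\in\Theta^c}\exp\langle y,\tau\rangle$. A least squares estimator $\theta_T$ of $\theta$ is any random vector with values in $\Theta^c$ which almost surely minimizes $Q_T(\tau)=\int_0^T[X(t)-a(t,\tau)]^2\,dt$ over $\tau\in\Theta^c$. Then there exist $T_0,R_0>0$ such that for every $\beta>0$ there are constants $B>0$ and $b>0$ with $$b\ \ge\ \frac{L^2\lambda_{\min}(J)}{16\pi f_0(1+q)}-\beta$$ such that for every $\theta\in\Theta$, all $T>T_0$, $R>R_0$ and every least squares estimator $\theta_T$ of $\theta$,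 $$P\bigl\{\|T^{1/2}(\theta_T-\theta)\|\ge R\bigr\}\le B\exp\{-bR^2\}.$$ (In the degenerate case $f_0=0$, where the noise vanishes almost surely, the quotient is read as $0$.) -/

import Mathlib

open MeasureTheory Filter Topology Set
open scoped ENNReal FourierTransform

noncomputable section

namespace SubGaussianRegression

section Processes

variable {Ω : Type*} [MeasurableSpace Ω]

/-- The random vector `(ξ 0, …, ξ (n-1))` is strictly sub-Gaussian: for every real vector `D`,
`E exp ⟨ξ, D⟩ ≤ exp (½ ∑ᵢⱼ E[ξᵢ ξⱼ] Dᵢ Dⱼ)`. -/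
structure IsStrictlySubGaussian (P : Measure Ω) {n : ℕ} (ξ : Fin n → Ω → ℝ) : Prop where
  memLp : ∀ i, MemLp (ξ i) 2 P
  integrable_exp : ∀ D : Fin n → ℝ, Integrable (fun ω => Real.exp (∑ i, ξ i ω * D i)) P
  exp_le : ∀ D : Fin n → ℝ,
    ∫ ω, Real.exp (∑ i, ξ i ω * D i) ∂P ≤
      Real.exp ((1 / 2) * ∑ i, ∑ j, (∫ ω, ξ i ω * ξ j ω ∂P) * D i * D j)

/-- Jointly strictly sub-Gaussian process: all finite-dimensional vectors are strictly
sub-Gaussian. -/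
def IsJointlyStrictlySubGaussian (P : Measure Ω) (ξ : ℝ → Ω → ℝ) : Prop :=
  ∀ (n : ℕ) (t : Fin n → ℝ), IsStrictlySubGaussian P (fun i => ξ (t i))

/-- A square integrable process on `ℝ` that is continuous in mean square. -/
structure IsMeanSquareContinuous (P : Measure Ω) (ξ : ℝ → Ω → ℝ) : Prop where
  memLp : ∀ t, MemLp (ξ t) 2 P
  tendsto : ∀ t, Tendsto (fun s => ∫ ω, (ξ s ω - ξ t ω) ^ 2 ∂P) (𝓝 t) (𝓝 0)

/-- The noise condition: a centred process on `ℝ`, continuous in mean square and almost surely. -/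
structure IsCentredContinuousNoise (P : Measure Ω) (ε : ℝ → Ω → ℝ) : Prop where
  measurable : ∀ t, Measurable (ε t)
  meanSquareContinuous : IsMeanSquareContinuous P ε
  ae_continuous : ∀ᵐ ω ∂P, Continuous (fun t => ε t ω)
  mean_zero : ∀ t, ∫ ω, ε t ω ∂P = 0

/-- The driving process: a centred, mean-square continuous, jointly strictly sub-Gaussian process
on `ℝ` with orthogonal increments and `E (ξ (t + s) - ξ t)² = s` for `s > 0`. -/
structure IsIntegratedWhiteNoise (P : Measure Ω) (ξ : ℝ → Ω → ℝ) : Prop where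
  measurable : ∀ t, Measurable (ξ t)
  meanSquareContinuous : IsMeanSquareContinuous P ξ
  jointlyStrictlySubGaussian : IsJointlyStrictlySubGaussian P ξ
  mean_zero : ∀ t, ∫ ω, ξ t ω ∂P = 0
  orthogonal_increments : ∀ t₁ t₂ t₃ t₄ : ℝ, t₁ < t₂ → t₂ ≤ t₃ → t₃ < t₄ →
    ∫ ω, (ξ t₂ ω - ξ t₁ ω) * (ξ t₄ ω - ξ t₃ ω) ∂P = 0
  increment_variance : ∀ t s : ℝ, 0 < s → ∫ ω, |ξ (t + s) ω - ξ t ω| ^ 2 ∂P = s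

/-- Data of a simple function `∑ₗ c l • 1_[left l, right l)` on the line. -/
structure StepFunction where
  n : ℕ
  c : Fin n → ℝ
  left : Fin n → ℝ
  right : Fin n → ℝ
  left_le_right : ∀ l, left l ≤ right l

/-- The function on the line given by a `StepFunction`. -/
def StepFunction.eval (φ : StepFunction) (s : ℝ) : ℝ :=
  ∑ l, (Ico (φ.left l) (φ.right l)).indicator (fun _ => φ.c l) s

/-- The elementary stochastic integral `∫ φ dξ = ∑ₗ c l (ξ (right l) - ξ (left l))`. -/
def StepFunction.integral (φ : StepFunction) (ξ : ℝ → Ω → ℝ) (ω : Ω) : ℝ :=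
  ∑ l, φ.c l * (ξ (φ.right l) ω - ξ (φ.left l) ω)

/-- `η` is (a version of) the mean-square Stieltjes integral `∫_{-∞}^{∞} f(s) dξ(s)`: the limit in
`L²(P)` of elementary integrals of simple functions that converge to `f` in `L²(ℝ)`. -/
def IsMeanSquareIntegral (P : Measure Ω) (ξ : ℝ → Ω → ℝ) (f : ℝ → ℝ) (η : Ω → ℝ) : Prop :=
  MemLp η 2 P ∧ ∃ φ : ℕ → StepFunction,
    Tendsto (fun m => eLpNorm (fun s => f s - (φ m).eval s) 2 volume) atTop (𝓝 0) ∧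
    Tendsto (fun m => eLpNorm (fun ω => η ω - (φ m).integral ξ ω) 2 P) atTop (𝓝 0)

end Processes

/-- The transfer function `h(iλ) = (2π)^(-1/2) ∫ ψ(t) e^(-iλt) dt` of `ψ ∈ L²(ℝ)`, where the
integral is the Fourier–Plancherel transform. Mathlib's transform has kernel `e^(-2πixt)`, hence
the evaluation at `λ / (2π)`. It is defined up to a null set. -/
def transfer (ψ : ℝ → ℝ) (hψ : MemLp ψ 2 volume) (lam : ℝ) : ℂ :=
  ((Real.sqrt (2 * Real.pi))⁻¹ : ℝ) *
    (𝓕 (MemLp.toLp (fun t => (ψ t : ℂ)) hψ.ofReal) : Lp ℂ 2 (volume : Measure ℝ))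
      (lam / (2 * Real.pi))

/-- `f₀ = sup_λ |h(iλ)|²`, an essential supremum because `h` is defined almost everywhere. -/
def spectralSup (ψ : ℝ → ℝ) (hψ : MemLp ψ 2 volume) : ℝ≥0∞ :=
  essSup (fun lam : ℝ => ENNReal.ofReal (‖transfer ψ hψ lam‖ ^ 2)) volume

/-- The regression function `a(t, τ) = exp ⟨τ, y(t)⟩`. -/
def expRegression {q : ℕ} (y : ℝ → EuclideanSpace ℝ (Fin q)) (t : ℝ)
    (τ : EuclideanSpace ℝ (Fin q)) : ℝ :=
  Real.exp (inner ℝ τ (y t))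

/-- The least squares functional `Q_T(τ) = ∫₀ᵀ (X(t) - a(t, τ))² dt`. -/
def lsFunctional {q : ℕ} (a : ℝ → EuclideanSpace ℝ (Fin q) → ℝ) (x : ℝ → ℝ) (T : ℝ)
    (τ : EuclideanSpace ℝ (Fin q)) : ℝ :=
  ∫ t in (0 : ℝ)..T, (x t - a t τ) ^ 2

/-- `est` is a least squares estimator from the observations `X(t)`, `t ∈ [0, T]`: a random vector
with values in the closure of `Θ` that (almost surely) minimizes `Q_T` over the closure of `Θ`. -/
structure IsLSE {Ω : Type*} [MeasurableSpace Ω] (P : Measure Ω) {q : ℕ}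
    (Θ : Set (EuclideanSpace ℝ (Fin q))) (a : ℝ → EuclideanSpace ℝ (Fin q) → ℝ)
    (X : ℝ → Ω → ℝ) (T : ℝ) (est : Ω → EuclideanSpace ℝ (Fin q)) : Prop where
  measurable : Measurable est
  ae_mem : ∀ᵐ ω ∂P, est ω ∈ closure Θ
  ae_isMinOn : ∀ᵐ ω ∂P,
    IsMinOn (lsFunctional a (fun t => X t ω) T) (closure Θ) (est ω)

/-- The matrix `J_T = (T⁻¹ ∫₀ᵀ y_i(t) y_j(t) dt)_{ij}`. -/
def gramAverage {q : ℕ} (y : ℝ → EuclideanSpace ℝ (Fin q)) (T : ℝ) :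
    Matrix (Fin q) (Fin q) ℝ :=
  Matrix.of fun i j => T⁻¹ * ∫ t in (0 : ℝ)..T, y t i * y t j

/-- The least eigenvalue of a symmetric matrix. -/
def leastEigenvalue {q : ℕ} (J : Matrix (Fin q) (Fin q) ℝ) (hJ : J.IsHermitian) : ℝ :=
  ⨅ i, hJ.eigenvalues i

/-- `L = min {exp ⟨y, τ⟩ : y ∈ Y, τ ∈ closure Θ}`. -/
def minExp {q : ℕ} (Y Θ : Set (EuclideanSpace ℝ (Fin q))) : ℝ :=
  sInf {r : ℝ | ∃ y ∈ Y, ∃ τ ∈ closure Θ, r = Real.exp (inner ℝ y τ)}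

end SubGaussianRegression

end

/-! Write `v = est - θ` and let `diffQuot θ v` be the difference quotient of the regression function
in direction `v`. Comparing the least squares functional at `est` and at `θ` gives `‖v‖ ∫ diffQuot²
≤ 2 ∫ ε · diffQuot` (`norm_mul_integral_sq_le_of_lsFunctional_le`). The integral on the left is at
least `T m` with `m` close to `L² λ_min(J)`, because `exp` has slope at least `L` on the relevant
range and the Gram averages converge (`le_integral_diffQuot_sq`). A large error therefore forces a
linear functional of the noise to be large.

For a fixed continuous `g`, the functional `∫₀ᵀ ε g` is sub-Gaussian with variance proxy `2π f₀ ∫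
g²` (`hasSubgaussianMGF_integral_mul`). Strict sub-Gaussianity passes from `ξ` to mean-square
integrals by the isometry and Fatou. Riemann-type sums approximate `∫ ε g`, and Plancherel turns the
norm of the resulting kernel into a frequency integral on which the spectral bound acts pointwise.
For one fixed direction, Chernoff's bound then gives the required rate.

The direction `v` is random, so uniformity in `v` is needed. Expanding the exponential in monomials
of `y(t)` separates `v`, which enters only through coefficients, from the noise, which enters only
through countably many functionals free of `v`. All of these are controlled at once by a union bound
(`measure_iUnion_coordinate_gt_le`). Off that exceptional event the noise functional is Lipschitz in
`(v/‖v‖, v)` with constant proportional to `√T R`. A finite partition into cells of a fixed size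
`δ`, independent of `T` and `R`, then reduces the problem to one representative per cell
(`measure_lse_le`).

The partition affects only the prefactor `B`, and the approximations cost a fixed fraction of the
exponent. Since `1 + q ≥ 2`, the target constant leaves a factor of two to spare, which absorbs that
loss; the resulting `b` does not depend on `β`. -/

namespace SubGaussianRegression

/-! ### Plancherel theory: translations become characters. -/

section Fourier

open SchwartzMap

/-- The `L²` Fourier transform tested against a Schwartz function. -/
theorem integral_smul_fourier_Lp (F : Lp ℂ 2 (volume : Measure ℝ)) (φ : 𝓢(ℝ, ℂ)) :
    ∫ x, φ x • (𝓕 F : Lp ℂ 2 (volume : Measure ℝ)) x = ∫ x, 𝓕 (φ : ℝ → ℂ) x • F x := by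
  have h := congrArg (fun D => D φ) (Lp.fourier_toTemperedDistribution_eq F)
  simp only [TemperedDistribution.fourier_apply, Lp.toTemperedDistribution_apply,
    SchwartzMap.fourier_coe] at h
  exact h.symm

theorem ae_eq_of_integral_schwartz {f g : ℝ → ℂ} (hf : LocallyIntegrable f)
    (hg : LocallyIntegrable g)
    (h : ∀ φ : 𝓢(ℝ, ℂ), HasCompactSupport φ → ∫ x, φ x • f x = ∫ x, φ x • g x) :
    f =ᵐ[volume] g := by
  refine ae_eq_of_integral_contDiff_smul_eq hf hg fun u hu hc => ?_
  have hu' : ContDiff ℝ (⊤ : ℕ∞) (fun x => (u x : ℂ)) := Complex.ofRealCLM.contDiff.comp hu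
  have hc' : HasCompactSupport (fun x => (u x : ℂ)) := hc.comp_left (g := ((↑) : ℝ → ℂ)) rfl
  simpa using h (hc'.toSchwartzMap hu') hc'

/-- Both transforms can be moved onto a test function, the `L²` one by duality and the integral one
by Fubini, so they define the same distribution. -/
theorem fourier_toLp_ae_eq {G : ℝ → ℂ} (hG : Integrable G) (hG2 : MemLp G 2) :
    (𝓕 (hG2.toLp G) : Lp ℂ 2 (volume : Measure ℝ)) =ᵐ[volume] 𝓕 G := by
  refine ae_eq_of_integral_schwartz ((Lp.memLp _).locallyIntegrable (by norm_num)) ?_ ?_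
  · exact (VectorFourier.fourierIntegral_continuous Real.continuous_fourierChar
      continuous_inner hG).locallyIntegrable
  intro φ _
  rw [integral_smul_fourier_Lp]
  have h1 : ∫ x, 𝓕 (φ : ℝ → ℂ) x • (hG2.toLp G) x = ∫ x, 𝓕 (φ : ℝ → ℂ) x • G x :=
    integral_congr_ae (by filter_upwards [hG2.coeFn_toLp] with x hx; rw [hx])
  rw [h1]
  have h2 := VectorFourier.integral_fourierIntegral_smul_eq_flip (μ := volume) (ν := volume)
    (L := innerₗ ℝ) Real.continuous_fourierChar continuous_inner φ.integrable hG
  rw [flip_innerₗ] at h2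
  exact h2

theorem eLpNorm_fourier {G : ℝ → ℂ} (hG : Integrable G) (hG2 : MemLp G 2) :
    eLpNorm (𝓕 G) 2 volume = eLpNorm G 2 volume := by
  rw [← eLpNorm_congr_ae (fourier_toLp_ae_eq hG hG2), ← eLpNorm_congr_ae hG2.coeFn_toLp]
  have h := Lp.norm_fourier_eq (hG2.toLp G)
  rw [Lp.norm_def, Lp.norm_def, ENNReal.toReal_eq_toReal_iff' (Lp.eLpNorm_ne_top _)
    (Lp.eLpNorm_ne_top _)] at h
  exact h

/-- The character `x ↦ exp (2πi c x)`. -/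
noncomputable def char (c x : ℝ) : ℂ := Complex.exp ((2 * Real.pi * c * x : ℝ) * Complex.I)

theorem norm_char (c x : ℝ) : ‖char c x‖ = 1 := Complex.norm_exp_ofReal_mul_I _

theorem contDiff_char (c : ℝ) : ContDiff ℝ (⊤ : ℕ∞) (char c) := by
  unfold char
  refine ContDiff.cexp (ContDiff.mul (Complex.ofRealCLM.contDiff.comp ?_) contDiff_const)
  exact contDiff_const.mul contDiff_id

theorem measurePreserving_add_const (c : ℝ) :
    MeasurePreserving (fun x : ℝ => x + c) volume volume := measurePreserving_add_right _ c

/-- A compactly supported test function times `char c` is again Schwartz, and its transform is the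
translated transform. The identity then follows by translation invariance of Lebesgue measure. -/
theorem fourier_translate (F : Lp ℂ 2 (volume : Measure ℝ)) (c : ℝ) :
    (𝓕 (Lp.compMeasurePreserving _ (measurePreserving_add_const c) F) :
      Lp ℂ 2 (volume : Measure ℝ)) =ᵐ[volume]
      fun x => char c x * (𝓕 F : Lp ℂ 2 (volume : Measure ℝ)) x := by
  have hloc : LocallyIntegrable (𝓕 F : Lp ℂ 2 (volume : Measure ℝ)) :=
    (Lp.memLp _).locallyIntegrable (by norm_num)
  refine ae_eq_of_integral_schwartz ((Lp.memLp _).locallyIntegrable (by norm_num)) ?_ ?_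
  · have := hloc.locallyIntegrableOn univ |>.continuousOn_mul
      (contDiff_char c).continuous.continuousOn isOpen_univ.isLocallyClosed
    exact locallyIntegrableOn_univ.1 this
  intro φ hφ
  have hs : ContDiff ℝ (⊤ : ℕ∞) (fun x => char c x * φ x) := (contDiff_char c).mul (φ.smooth _)
  have hc : HasCompactSupport (fun x => char c x * φ x) := hφ.mul_left
  have h1 := integral_smul_fourier_Lp F (hc.toSchwartzMap hs)
  rw [integral_smul_fourier_Lp]
  have h2 : ∀ x, 𝓕 (fun x => char c x * φ x) x = 𝓕 (φ : ℝ → ℂ) (x - c) := by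
    intro x
    rw [Real.fourier_eq', Real.fourier_eq']
    refine integral_congr_ae (Eventually.of_forall fun v => ?_)
    simp only [smul_eq_mul, char, ← mul_assoc, ← Complex.exp_add]
    congr 2
    simp only [RCLike.inner_apply, conj_trivial]
    push_cast
    ring
  have h3 : (fun x => ((Lp.compMeasurePreserving _ (measurePreserving_add_const c) F :
      Lp ℂ 2 (volume : Measure ℝ)) x)) =ᵐ[volume] fun x => F (x + c) :=
    Lp.coeFn_compMeasurePreserving F (measurePreserving_add_const c)
  calc _ = ∫ x, 𝓕 (φ : ℝ → ℂ) x • F (x + c) :=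
        integral_congr_ae (by filter_upwards [h3] with x hx; rw [hx])
    _ = ∫ x, 𝓕 (φ : ℝ → ℂ) (x - c) • F x := by
        rw [← integral_add_right_eq_self (fun x => 𝓕 (φ : ℝ → ℂ) (x - c) • F x) c]
        simp
    _ = _ := by
        simp only [← h2]
        refine h1.symm.trans (integral_congr_ae (Eventually.of_forall fun x => ?_))
        change char c x * φ x * _ = φ x * (char c x * _)
        ring

/-- The left side is the norm of the kernel representing `∑ c x · ε x` as an integral against `ξ`.
After the reflection `u ↦ -u` the kernel is a combination of translates of `ψ`, and Plancherel makes
it a trigonometric sum times the transform of `ψ`. -/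
theorem eLpNorm_sum_translate {ψ : ℝ → ℝ} (hψ : MemLp ψ 2 volume) (A : Finset ℝ)
    (c : ℝ → ℝ) :
    eLpNorm (fun u => ∑ x ∈ A, c x * ψ (x - u)) 2 volume =
      eLpNorm (fun s => (∑ x ∈ A, c x * char x s) *
        (𝓕 (MemLp.toLp (fun t => (ψ t : ℂ)) hψ.ofReal) : Lp ℂ 2 (volume : Measure ℝ)) s)
        2 volume := by
  set F := MemLp.toLp (fun t => (ψ t : ℂ)) hψ.ofReal with hF
  let τ : ℝ → Lp ℂ 2 (volume : Measure ℝ) := fun x =>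
    Lp.compMeasurePreserving _ (measurePreserving_add_const x) F
  have hτ : ∀ x, (τ x : ℝ → ℂ) =ᵐ[volume] fun u => (ψ (x + u) : ℂ) := by
    intro x
    have h1 := Lp.coeFn_compMeasurePreserving F (measurePreserving_add_const x)
    have h2 := (measurePreserving_add_const x).quasiMeasurePreserving.ae_eq_comp
      (MemLp.coeFn_toLp (E := ℂ) hψ.ofReal)
    filter_upwards [h1, h2] with u hu1 hu2
    rw [hu1]
    exact hu2.trans (by simp [add_comm])
  set H : Lp ℂ 2 (volume : Measure ℝ) := ∑ x ∈ A, (c x : ℂ) • τ x with hH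
  have hsum : ∀ (v : ℝ → Lp ℂ 2 (volume : Measure ℝ)),
      ((∑ x ∈ A, (c x : ℂ) • v x : Lp ℂ 2 (volume : Measure ℝ)) : ℝ → ℂ) =ᵐ[volume]
        fun u => ∑ x ∈ A, (c x : ℂ) * v x u := by
    intro v
    have h1 := Lp.coeFn_finsetSum A (fun x => (c x : ℂ) • v x)
    have h2 : ∀ᵐ u, ∀ x ∈ A, ((c x : ℂ) • v x : Lp ℂ 2 (volume : Measure ℝ)) u
        = (c x : ℂ) * v x u :=
      (A.eventually_all).2 fun x _ => by
        filter_upwards [Lp.coeFn_smul (c x : ℂ) (v x)] with u hu using by simpa using hu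
    filter_upwards [h1, h2] with u hu1 hu2
    rw [hu1, Finset.sum_apply]
    exact Finset.sum_congr rfl hu2
  have h1 : eLpNorm (fun u => ∑ x ∈ A, c x * ψ (x - u)) 2 volume = eLpNorm H 2 volume := by
    rw [← eLpNorm_comp_measurePreserving (Lp.aestronglyMeasurable H)
      (Measure.measurePreserving_neg (volume : Measure ℝ))]
    refine eLpNorm_congr_norm_ae ?_
    have h3 : ∀ᵐ u, ∀ x ∈ A, τ x u = (ψ (x + u) : ℂ) :=
      (A.eventually_all).2 fun x _ => hτ x
    have h4 : ∀ᵐ u, H u = ∑ x ∈ A, (c x : ℂ) * (ψ (x + u) : ℂ) := by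
      filter_upwards [h3, hsum τ] with u hu hu'
      rw [hH, hu']
      exact Finset.sum_congr rfl fun x hx => by rw [hu x hx]
    have h5 := (Measure.measurePreserving_neg
      (volume : Measure ℝ)).quasiMeasurePreserving.ae h4
    filter_upwards [h5] with u hu
    rw [Function.comp, hu, ← Complex.norm_real]
    push_cast
    simp [sub_eq_add_neg]
  have h2 : eLpNorm H 2 volume = eLpNorm (𝓕 H : Lp ℂ 2 (volume : Measure ℝ)) 2 volume := by
    have h := Lp.norm_fourier_eq H
    rw [Lp.norm_def, Lp.norm_def, ENNReal.toReal_eq_toReal_iff' (Lp.eLpNorm_ne_top _)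
      (Lp.eLpNorm_ne_top _)] at h
    exact h.symm
  have h3 : (𝓕 H : Lp ℂ 2 (volume : Measure ℝ)) = ∑ x ∈ A, (c x : ℂ) • 𝓕 (τ x) := by
    change Lp.fourierTransformₗᵢ ℝ ℂ H = ∑ x ∈ A, (c x : ℂ) • Lp.fourierTransformₗᵢ ℝ ℂ (τ x)
    rw [hH, map_sum]
    exact Finset.sum_congr rfl fun x _ => map_smul _ _ _
  rw [h1, h2, h3]
  refine eLpNorm_congr_ae ?_
  have h4 : ∀ᵐ s, ∀ x ∈ A, (𝓕 (τ x) : Lp ℂ 2 (volume : Measure ℝ)) s = char x s *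
      (𝓕 F : Lp ℂ 2 (volume : Measure ℝ)) s :=
    (A.eventually_all).2 fun x _ => fourier_translate F x
  filter_upwards [hsum fun x => 𝓕 (τ x), h4] with s hs hs'
  rw [hs, Finset.sum_mul]
  exact Finset.sum_congr rfl fun x hx => by rw [hs' x hx, mul_assoc]

end Fourier

/-! ### Isometry and exponential moments of elementary integrals. -/

section Isometry

variable {Ω : Type*} [MeasurableSpace Ω] {P : Measure Ω} {ξ : ℝ → Ω → ℝ}

theorem IsIntegratedWhiteNoise.memLp_sub (h : IsIntegratedWhiteNoise P ξ) (s t : ℝ) :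
    MemLp (fun ω => ξ t ω - ξ s ω) 2 P :=
  (h.meanSquareContinuous.memLp t).sub (h.meanSquareContinuous.memLp s)

theorem IsIntegratedWhiteNoise.integral_sq_sub (h : IsIntegratedWhiteNoise P ξ) (s t : ℝ) :
    ∫ ω, (ξ t ω - ξ s ω) ^ 2 ∂P = |t - s| := by
  rcases lt_trichotomy s t with hst | rfl | hst
  · have := h.increment_variance s (t - s) (by linarith)
    simp only [add_sub_cancel, sq_abs] at this
    rw [this, abs_of_pos (by linarith)]
  · simp
  · have := h.increment_variance t (s - t) (by linarith)
    simp only [add_sub_cancel, sq_abs] at this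
    rw [abs_of_neg (by linarith), neg_sub, ← this]
    congr 1
    ext ω
    ring

/-- This form of the overlap length avoids a case split on the order of the endpoints and coincides
with what polarization yields for increments of `ξ`. -/
theorem integral_indicator_Ico_mul (a b c d : ℝ) (hab : a ≤ b) (hcd : c ≤ d) :
    ∫ s, (Ico a b).indicator (fun _ => (1 : ℝ)) s * (Ico c d).indicator (fun _ => (1 : ℝ)) s =
      (|b - c| + |d - a| - |b - d| - |a - c|) / 2 := by
  have h1 : (fun s => (Ico a b).indicator (fun _ => (1 : ℝ)) s *
      (Ico c d).indicator (fun _ => (1 : ℝ)) s) =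
      (Ico (max a c) (min b d)).indicator (fun _ => (1 : ℝ)) := by
    ext s
    rw [← Ico_inter_Ico]
    by_cases h1 : s ∈ Ico a b <;> by_cases h2 : s ∈ Ico c d <;> simp [indicator, h1, h2]
  rw [h1, integral_indicator measurableSet_Ico]
  simp only [integral_const, smul_eq_mul, mul_one, measureReal_restrict_apply_univ, Real.volume_real_Ico]
  grind

/-- By polarization the product of two increments is a combination of four squared increments, whose
expectations are interval lengths. -/
theorem IsIntegratedWhiteNoise.integral_mul_sub (h : IsIntegratedWhiteNoise P ξ) (a b c d : ℝ) :
    ∫ ω, (ξ b ω - ξ a ω) * (ξ d ω - ξ c ω) ∂P =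
      (|b - c| + |d - a| - |b - d| - |a - c|) / 2 := by
  have hi : ∀ s t, Integrable (fun ω => (ξ t ω - ξ s ω) ^ 2) P := fun s t =>
    (h.memLp_sub s t).integrable_sq
  have h1 : (fun ω => (ξ b ω - ξ a ω) * (ξ d ω - ξ c ω)) = fun ω =>
      ((ξ b ω - ξ c ω) ^ 2 + (ξ d ω - ξ a ω) ^ 2 - (ξ b ω - ξ d ω) ^ 2 -
        (ξ a ω - ξ c ω) ^ 2) / 2 := by
    ext ω
    ring
  rw [h1, integral_div, integral_sub, integral_sub, integral_add]
  · simp only [h.integral_sq_sub]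
  · exact hi _ _
  · exact hi _ _
  · exact (hi _ _).add (hi _ _)
  · exact hi _ _
  · exact ((hi _ _).add (hi _ _)).sub (hi _ _)
  · exact hi _ _

theorem StepFunction.memLp_eval (φ : StepFunction) : MemLp φ.eval 2 volume := by
  have : φ.eval = fun s => ∑ l, (Ico (φ.left l) (φ.right l)).indicator (fun _ => φ.c l) s := rfl
  rw [this]
  exact memLp_finsetSum _ fun l _ =>
    memLp_indicator_const 2 measurableSet_Ico _ (Or.inr measure_Ico_lt_top.ne)

theorem StepFunction.memLp_integral (φ : StepFunction) (h : IsIntegratedWhiteNoise P ξ) :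
    MemLp (φ.integral ξ) 2 P := by
  have : φ.integral ξ = fun ω => ∑ l, φ.c l * (ξ (φ.right l) ω - ξ (φ.left l) ω) := rfl
  rw [this]
  exact memLp_finsetSum _ fun l _ => (h.memLp_sub _ _).const_mul _

theorem StepFunction.integral_sq (φ : StepFunction) (h : IsIntegratedWhiteNoise P ξ) :
    ∫ ω, φ.integral ξ ω ^ 2 ∂P = ∫ s, φ.eval s ^ 2 := by
  have hL : (fun ω => φ.integral ξ ω ^ 2) = fun ω => ∑ k, ∑ l, (φ.c k * φ.c l) *
      ((ξ (φ.right k) ω - ξ (φ.left k) ω) * (ξ (φ.right l) ω - ξ (φ.left l) ω)) := by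
    ext ω
    rw [StepFunction.integral, sq, Finset.sum_mul_sum]
    exact Finset.sum_congr rfl fun k _ => Finset.sum_congr rfl fun l _ => by ring
  have hR : (fun s => φ.eval s ^ 2) = fun s => ∑ k, ∑ l, (φ.c k * φ.c l) *
      ((Ico (φ.left k) (φ.right k)).indicator (fun _ => (1 : ℝ)) s *
        (Ico (φ.left l) (φ.right l)).indicator (fun _ => (1 : ℝ)) s) := by
    ext s
    rw [StepFunction.eval, sq, Finset.sum_mul_sum]
    refine Finset.sum_congr rfl fun k _ => Finset.sum_congr rfl fun l _ => ?_
    simp only [indicator_apply]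
    split_ifs <;> simp
  have hi1 : ∀ k l, Integrable (fun ω => (φ.c k * φ.c l) *
      ((ξ (φ.right k) ω - ξ (φ.left k) ω) * (ξ (φ.right l) ω - ξ (φ.left l) ω))) P :=
    fun k l => ((h.memLp_sub _ _).integrable_mul (h.memLp_sub _ _)).const_mul _
  have hm : ∀ a b : ℝ, MemLp ((Ico a b).indicator (fun _ => (1 : ℝ))) 2 volume := fun a b =>
    memLp_indicator_const 2 measurableSet_Ico _ (Or.inr measure_Ico_lt_top.ne)
  have hi2 : ∀ k l, Integrable (fun s => (φ.c k * φ.c l) *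
      ((Ico (φ.left k) (φ.right k)).indicator (fun _ => (1 : ℝ)) s *
        (Ico (φ.left l) (φ.right l)).indicator (fun _ => (1 : ℝ)) s)) :=
    fun k l => ((hm _ _).integrable_mul (hm _ _)).const_mul _
  rw [hL, hR, integral_finsetSum _ fun k _ => integrable_finsetSum _ fun l _ => hi1 k l,
    integral_finsetSum _ fun k _ => integrable_finsetSum _ fun l _ => hi2 k l]
  refine Finset.sum_congr rfl fun k _ => ?_
  rw [integral_finsetSum _ fun l _ => hi1 k l, integral_finsetSum _ fun l _ => hi2 k l]
  refine Finset.sum_congr rfl fun l _ => ?_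
  rw [integral_const_mul, integral_const_mul, h.integral_mul_sub,
    integral_indicator_Ico_mul _ _ _ _ (φ.left_le_right k) (φ.left_le_right l)]

theorem IsStrictlySubGaussian.integral_exp_le {n : ℕ} {X : Fin n → Ω → ℝ}
    (h : IsStrictlySubGaussian P X) (D : Fin n → ℝ) :
    ∫ ω, Real.exp (∑ i, X i ω * D i) ∂P ≤
      Real.exp ((1 / 2) * ∫ ω, (∑ i, X i ω * D i) ^ 2 ∂P) := by
  refine (h.exp_le D).trans_eq ?_
  have hi : ∀ i j, Integrable (fun ω => X i ω * X j ω * D i * D j) P := fun i j =>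
    (((h.memLp i).integrable_mul (h.memLp j)).mul_const _).mul_const _
  have h1 : (fun ω => (∑ i, X i ω * D i) ^ 2) = fun ω => ∑ i, ∑ j, X i ω * X j ω * D i * D j := by
    ext ω
    rw [sq, Finset.sum_mul_sum]
    exact Finset.sum_congr rfl fun k _ => Finset.sum_congr rfl fun l _ => by ring
  rw [h1, integral_finsetSum _ fun k _ => integrable_finsetSum _ fun l _ => hi k l]
  congr 2
  refine Finset.sum_congr rfl fun k _ => ?_
  rw [integral_finsetSum _ fun l _ => hi k l]
  refine Finset.sum_congr rfl fun l _ => ?_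
  rw [integral_mul_const, integral_mul_const]

/-- Puts the elementary integral in the form of a linear combination of values of `ξ`, to which
joint strict sub-Gaussianity applies directly. -/
theorem StepFunction.integral_eq_sum_append {Ω : Type*} (φ : StepFunction) (ξ : ℝ → Ω → ℝ) (ω : Ω) :
    φ.integral ξ ω = ∑ i, ξ (Fin.append φ.right φ.left i) ω *
      Fin.append φ.c (fun l => -φ.c l) i := by
  rw [Fin.sum_univ_add]
  simp only [Fin.append_left, Fin.append_right, ← Finset.sum_add_distrib, StepFunction.integral]
  exact Finset.sum_congr rfl fun l _ => by ring

theorem StepFunction.lintegral_exp_le (φ : StepFunction) (h : IsIntegratedWhiteNoise P ξ) :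
    ∫⁻ ω, ENNReal.ofReal (Real.exp (φ.integral ξ ω)) ∂P ≤
      ENNReal.ofReal (Real.exp ((1 / 2) * ∫ s, φ.eval s ^ 2)) := by
  have h1 := h.jointlyStrictlySubGaussian _ (Fin.append φ.right φ.left)
  have h2 := h1.integral_exp_le (Fin.append φ.c (fun l => -φ.c l))
  have h3 := h1.integrable_exp (Fin.append φ.c (fun l => -φ.c l))
  simp only [← φ.integral_eq_sum_append] at h2 h3
  rw [φ.integral_sq h] at h2
  rw [← ofReal_integral_eq_lintegral_ofReal h3 (Eventually.of_forall fun ω => Real.exp_nonneg _)]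
  exact ENNReal.ofReal_le_ofReal h2

end Isometry

/-! ### Linearity and exponential moments of the mean-square integral. -/

section MeanSquareIntegral

variable {Ω : Type*} [MeasurableSpace Ω] {P : Measure Ω} {ξ : ℝ → Ω → ℝ}

/-- The sum of two step functions. -/
def StepFunction.add (φ χ : StepFunction) : StepFunction where
  n := φ.n + χ.n
  c := Fin.append φ.c χ.c
  left := Fin.append φ.left χ.left
  right := Fin.append φ.right χ.right
  left_le_right l := by
    refine Fin.addCases (fun i => ?_) (fun i => ?_) l
    · simpa using φ.left_le_right i
    · simpa using χ.left_le_right i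

/-- A scalar multiple of a step function. -/
def StepFunction.smul (r : ℝ) (φ : StepFunction) : StepFunction where
  n := φ.n
  c l := r * φ.c l
  left := φ.left
  right := φ.right
  left_le_right := φ.left_le_right

/-- The step function without steps. -/
def StepFunction.zero : StepFunction where
  n := 0
  c _ := 0
  left _ := 0
  right _ := 0
  left_le_right _ := le_rfl

theorem StepFunction.eval_add (φ χ : StepFunction) (s : ℝ) :
    (φ.add χ).eval s = φ.eval s + χ.eval s := by
  unfold StepFunction.eval StepFunction.add
  rw [Fin.sum_univ_add]
  simp

theorem StepFunction.integral_add {Ω : Type*} (φ χ : StepFunction) (ξ : ℝ → Ω → ℝ) (ω : Ω) :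
    (φ.add χ).integral ξ ω = φ.integral ξ ω + χ.integral ξ ω := by
  unfold StepFunction.integral StepFunction.add
  rw [Fin.sum_univ_add]
  simp

theorem StepFunction.eval_smul (r : ℝ) (φ : StepFunction) (s : ℝ) :
    (φ.smul r).eval s = r * φ.eval s := by
  unfold StepFunction.eval StepFunction.smul
  rw [Finset.mul_sum]
  exact Finset.sum_congr rfl fun l _ => by simp only [indicator_apply]; split_ifs <;> simp

theorem StepFunction.integral_smul {Ω : Type*} (r : ℝ) (φ : StepFunction) (ξ : ℝ → Ω → ℝ) (ω : Ω) :
    (φ.smul r).integral ξ ω = r * φ.integral ξ ω := by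
  unfold StepFunction.integral StepFunction.smul
  rw [Finset.mul_sum]
  exact Finset.sum_congr rfl fun l _ => by ring

theorem IsMeanSquareIntegral.zero : IsMeanSquareIntegral P ξ (fun _ => 0) (fun _ => 0) := by
  refine ⟨MemLp.zero, fun _ => StepFunction.zero, ?_, ?_⟩
  · simp [StepFunction.eval, StepFunction.zero]
  · simp [StepFunction.integral, StepFunction.zero]

theorem IsMeanSquareIntegral.const_mul {f : ℝ → ℝ} {η : Ω → ℝ}
    (h : IsMeanSquareIntegral P ξ f η) (r : ℝ) :
    IsMeanSquareIntegral P ξ (fun s => r * f s) (fun ω => r * η ω) := by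
  obtain ⟨h0, φ, h1, h2⟩ := h
  refine ⟨h0.const_mul r, fun m => (φ m).smul r, ?_, ?_⟩
  · have : ∀ m, (fun s => r * f s - ((φ m).smul r).eval s) =
        r • fun s => f s - (φ m).eval s := fun m => by
      ext s
      simp only [StepFunction.eval_smul, Pi.smul_apply, smul_eq_mul]
      ring
    simp only [this, eLpNorm_const_smul]
    simpa using ENNReal.Tendsto.const_mul h1 (Or.inr (by simp : ‖r‖ₑ ≠ ∞))
  · have : ∀ m, (fun ω => r * η ω - ((φ m).smul r).integral ξ ω) =
        r • fun ω => η ω - (φ m).integral ξ ω := fun m => by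
      ext s
      simp only [StepFunction.integral_smul, Pi.smul_apply, smul_eq_mul]
      ring
    simp only [this, eLpNorm_const_smul]
    simpa using ENNReal.Tendsto.const_mul h2 (Or.inr (by simp : ‖r‖ₑ ≠ ∞))

theorem IsMeanSquareIntegral.add (hξ : IsIntegratedWhiteNoise P ξ) {f g : ℝ → ℝ} {η ζ : Ω → ℝ}
    (hf : AEStronglyMeasurable f volume) (hg : AEStronglyMeasurable g volume)
    (h : IsMeanSquareIntegral P ξ f η) (h' : IsMeanSquareIntegral P ξ g ζ) :
    IsMeanSquareIntegral P ξ (fun s => f s + g s) (fun ω => η ω + ζ ω) := by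
  obtain ⟨h0, φ, h1, h2⟩ := h
  obtain ⟨h0', χ, h1', h2'⟩ := h'
  refine ⟨h0.add h0', fun m => (φ m).add (χ m), ?_, ?_⟩
  · refine tendsto_of_tendsto_of_tendsto_of_le_of_le tendsto_const_nhds
      (by simpa using h1.add h1') (fun _ => zero_le) fun m => ?_
    refine le_trans (le_of_eq ?_) (eLpNorm_add_le
      (hf.sub (φ m).memLp_eval.1) (hg.sub (χ m).memLp_eval.1) (by norm_num))
    congr 1
    ext s
    simp only [StepFunction.eval_add, Pi.add_apply]
    ring
  · refine tendsto_of_tendsto_of_tendsto_of_le_of_le tendsto_const_nhds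
      (by simpa using h2.add h2') (fun _ => zero_le) fun m => ?_
    refine le_trans (le_of_eq ?_) (eLpNorm_add_le
      (h0.1.sub ((φ m).memLp_integral hξ).1) (h0'.1.sub ((χ m).memLp_integral hξ).1)
      (by norm_num))
    congr 1
    ext s
    simp only [StepFunction.integral_add, Pi.add_apply]
    ring

theorem IsMeanSquareIntegral.sum (hξ : IsIntegratedWhiteNoise P ξ) {ι : Type*} (A : Finset ι)
    (c : ι → ℝ) {f : ι → ℝ → ℝ} {η : ι → Ω → ℝ} (hf : ∀ x, AEStronglyMeasurable (f x) volume)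
    (h : ∀ x ∈ A, IsMeanSquareIntegral P ξ (f x) (η x)) :
    IsMeanSquareIntegral P ξ (fun s => ∑ x ∈ A, c x * f x s) (fun ω => ∑ x ∈ A, c x * η x ω) := by
  classical
  induction A using Finset.induction_on with
  | empty => simpa using IsMeanSquareIntegral.zero
  | insert a A ha ih =>
    simp only [Finset.sum_insert ha]
    refine IsMeanSquareIntegral.add hξ ((hf a).const_mul _) ?_
      ((h a (Finset.mem_insert_self a A)).const_mul _)
      (ih fun x hx => h x (Finset.mem_insert_of_mem hx))
    exact Finset.aestronglyMeasurable_fun_sum A fun x _ => (hf x).const_mul _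

theorem sq_toReal_eLpNorm_two {α : Type*} [MeasurableSpace α] {μ : Measure α} {f : α → ℝ}
    (hf : MemLp f 2 μ) : (eLpNorm f 2 μ).toReal ^ 2 = ∫ x, f x ^ 2 ∂μ := by
  rw [hf.eLpNorm_eq_integral_rpow_norm (by norm_num) (by norm_num),
    ENNReal.toReal_ofReal (by positivity)]
  simp only [ENNReal.toReal_ofNat, Real.rpow_ofNat, Real.norm_eq_abs, sq_abs]
  rw [← one_div, ← Real.sqrt_eq_rpow, Real.sq_sqrt (integral_nonneg fun x => sq_nonneg _)]

/-- `L²` convergence gives an almost surely convergent subsequence of elementary integrals. Fatou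
carries their exponential bounds to the limit, while the norms of the step functions converge to
that of `f`. -/
theorem IsMeanSquareIntegral.lintegral_exp_le [IsFiniteMeasure P]
    (hξ : IsIntegratedWhiteNoise P ξ) {f : ℝ → ℝ} {η : Ω → ℝ} (hf : MemLp f 2 volume)
    (h : IsMeanSquareIntegral P ξ f η) :
    ∫⁻ ω, ENNReal.ofReal (Real.exp (η ω)) ∂P ≤
      ENNReal.ofReal (Real.exp ((1 / 2) * (eLpNorm f 2 volume).toReal ^ 2)) := by
  obtain ⟨h0, φ, h1, h2⟩ := h
  have h3 : TendstoInMeasure P (fun m => (φ m).integral ξ) atTop η := by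
    refine tendstoInMeasure_of_tendsto_eLpNorm (p := 2) (by norm_num)
      (fun m => ((φ m).memLp_integral hξ).1) h0.1 ?_
    refine h2.congr fun m => ?_
    exact eLpNorm_sub_comm _ _ _ _
  obtain ⟨k, hk, hlim⟩ := h3.exists_seq_tendsto_ae
  have h4 : Tendsto (fun m => eLpNorm (φ (k m)).eval 2 volume) atTop
      (𝓝 (eLpNorm f 2 volume)) := by
    have h5 := h1.comp hk.tendsto_atTop
    refine tendsto_of_tendsto_of_tendsto_of_le_of_le
      (g := fun m => eLpNorm f 2 volume - eLpNorm (fun s => f s - (φ (k m)).eval s) 2 volume)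
      (h := fun m => eLpNorm f 2 volume + eLpNorm (fun s => f s - (φ (k m)).eval s) 2 volume)
      ?_ ?_ (fun m => ?_) (fun m => ?_)
    · simpa using ENNReal.Tendsto.sub (tendsto_const_nhds (x := eLpNorm f 2 volume)) h5
        (Or.inl hf.2.ne)
    · simpa using (tendsto_const_nhds (x := eLpNorm f 2 volume)).add h5
    · rw [tsub_le_iff_right]
      refine le_trans (le_of_eq ?_) (eLpNorm_add_le (φ (k m)).memLp_eval.1
        (hf.1.sub (φ (k m)).memLp_eval.1) (by norm_num))
      congr 1
      ext s
      simp
    · refine le_trans (le_of_eq ?_) (eLpNorm_sub_le hf.1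
        (hf.1.sub (φ (k m)).memLp_eval.1) (by norm_num))
      congr 1
      ext s
      simp
  have h5 : Tendsto (fun m => ENNReal.ofReal (Real.exp ((1 / 2) * ∫ s, (φ (k m)).eval s ^ 2)))
      atTop (𝓝 (ENNReal.ofReal (Real.exp ((1 / 2) * (eLpNorm f 2 volume).toReal ^ 2)))) := by
    simp only [← fun m => sq_toReal_eLpNorm_two (φ m).memLp_eval]
    refine ENNReal.tendsto_ofReal ((Real.continuous_exp.tendsto _).comp
      (Tendsto.const_mul _ (Tendsto.pow ?_ 2)))
    exact (ENNReal.tendsto_toReal hf.2.ne).comp h4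
  calc ∫⁻ ω, ENNReal.ofReal (Real.exp (η ω)) ∂P
      = ∫⁻ ω, liminf (fun m => ENNReal.ofReal (Real.exp ((φ (k m)).integral ξ ω))) atTop ∂P := by
        refine lintegral_congr_ae ?_
        filter_upwards [hlim] with ω hω
        exact (ENNReal.tendsto_ofReal ((Real.continuous_exp.tendsto _).comp hω)).liminf_eq.symm
    _ ≤ liminf (fun m => ∫⁻ ω, ENNReal.ofReal (Real.exp ((φ (k m)).integral ξ ω)) ∂P) atTop :=
        lintegral_liminf_le' fun m => (Real.measurable_exp.comp_aemeasurable
          ((φ (k m)).memLp_integral hξ).1.aemeasurable).ennreal_ofReal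
    _ ≤ liminf (fun m => ENNReal.ofReal (Real.exp ((1 / 2) * ∫ s, (φ (k m)).eval s ^ 2)))
        atTop := liminf_le_liminf (Eventually.of_forall fun m => (φ (k m)).lintegral_exp_le hξ)
    _ = _ := h5.liminf_eq

end MeanSquareIntegral

/-! ### Quadrature sums for continuous integrands. -/

section Quadrature

/-- Simple functions with values in `[0, T]` converging to the identity there. -/
noncomputable def quadNodes (T : ℝ) (hT : 0 ≤ T) (n : ℕ) : SimpleFunc ℝ ℝ :=
  SimpleFunc.approxOn id measurable_id (Icc 0 T) 0 (left_mem_Icc.2 hT) n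

/-- The weight of a node of the quadrature rule on `[0, T]`. -/
noncomputable def quadWeight (T : ℝ) (hT : 0 ≤ T) (n : ℕ) (x : ℝ) : ℝ :=
  (volume.restrict (Icc 0 T)).real (quadNodes T hT n ⁻¹' {x})

variable {E : Type*} [NormedAddCommGroup E] [NormedSpace ℝ E] [CompleteSpace E]

theorem sum_quadWeight_smul (T : ℝ) (hT : 0 ≤ T) (n : ℕ) (F : ℝ → E) :
    ∑ x ∈ (quadNodes T hT n).range, quadWeight T hT n x • F x =
      ∫ t in Icc 0 T, F (quadNodes T hT n t) := by
  have h1 : ∀ t, F (quadNodes T hT n t) = ∑ x ∈ (quadNodes T hT n).range,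
      (quadNodes T hT n ⁻¹' {x}).indicator (fun _ => F x) t := by
    intro t
    rw [Finset.sum_eq_single (quadNodes T hT n t)]
    · simp
    · intro x _ hx
      simp [hx.symm]
    · simp
  simp only [h1]
  have hm : ∀ x, MeasurableSet (quadNodes T hT n ⁻¹' {x}) :=
    fun x => SimpleFunc.measurableSet_preimage _ _
  rw [integral_finsetSum]
  · refine Finset.sum_congr rfl fun x _ => ?_
    rw [integral_indicator_const _ (hm x)]
    rfl
  · intro x _
    exact (integrable_const _).indicator (hm x)

theorem quadNodes_mem (T : ℝ) (hT : 0 ≤ T) (n : ℕ) (t : ℝ) :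
    quadNodes T hT n t ∈ Icc 0 T := SimpleFunc.approxOn_mem _ _ _ _

theorem norm_sum_quadWeight_smul_le (T : ℝ) (hT : 0 ≤ T) (n : ℕ) {F : ℝ → E} {C : ℝ}
    (hC : ∀ t ∈ Icc 0 T, ‖F t‖ ≤ C) :
    ‖∑ x ∈ (quadNodes T hT n).range, quadWeight T hT n x • F x‖ ≤ C * T := by
  rw [sum_quadWeight_smul]
  have := norm_integral_le_of_norm_le_const (μ := volume.restrict (Icc 0 T))
    (f := fun t => F (quadNodes T hT n t)) (C := C)
    (Eventually.of_forall fun t => hC _ (quadNodes_mem T hT n t))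
  simpa [hT] using this

/-- The nodes and weights do not depend on `F`. The same sums therefore approximate both the
pathwise noise integral and, at every frequency, the transform of its weight. -/
theorem tendsto_sum_quadWeight_smul (T : ℝ) (hT : 0 ≤ T) {F : ℝ → E}
    (hF : ContinuousOn F (Icc 0 T)) :
    Tendsto (fun n => ∑ x ∈ (quadNodes T hT n).range, quadWeight T hT n x • F x) atTop
      (𝓝 (∫ t in (0 : ℝ)..T, F t)) := by
  simp only [sum_quadWeight_smul]
  rw [intervalIntegral.integral_of_le hT, ← integral_Icc_eq_integral_Ioc]
  obtain ⟨C, hC⟩ := isCompact_Icc.exists_bound_of_continuousOn hF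
  refine tendsto_integral_of_dominated_convergence (fun _ => C) (fun n => ?_)
    (integrable_const _) (fun n => Eventually.of_forall fun t => hC _ (quadNodes_mem T hT n t)) ?_
  · have : (fun t => F (quadNodes T hT n t)) = (quadNodes T hT n).map F := rfl
    rw [this]
    exact SimpleFunc.aestronglyMeasurable _
  · refine (ae_restrict_iff' measurableSet_Icc).2 (Eventually.of_forall fun t ht => ?_)
    have h1 : Tendsto (fun n => quadNodes T hT n t) atTop (𝓝[Icc 0 T] t) := by
      refine tendsto_nhdsWithin_iff.2 ⟨?_, Eventually.of_forall fun n => quadNodes_mem T hT n t⟩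
      exact SimpleFunc.tendsto_approxOn measurable_id _ (subset_closure ht)
    exact (hF t ht).tendsto.comp h1

end Quadrature

/-! ### The spectral bound and the transform of a weight on `[0, T]`. -/

section Spectral

theorem ae_norm_fourier_sq_le {ψ : ℝ → ℝ} (hψ : MemLp ψ 2 volume) (hf : spectralSup ψ hψ < ⊤) :
    ∀ᵐ s, ‖(𝓕 (MemLp.toLp (fun t => (ψ t : ℂ)) hψ.ofReal) : Lp ℂ 2 (volume : Measure ℝ)) s‖ ^ 2
      ≤ 2 * Real.pi * (spectralSup ψ hψ).toReal := by
  have h1 : ∀ᵐ lam, ENNReal.ofReal (‖transfer ψ hψ lam‖ ^ 2) ≤ spectralSup ψ hψ :=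
    ENNReal.ae_le_essSup _
  have hpi : (2 * Real.pi) ≠ 0 := by positivity
  -- The substitution `λ = 2π s` between the two frequency conventions must preserve null sets,
  -- since the bound holds only almost everywhere.
  have hq : Measure.QuasiMeasurePreserving (fun s : ℝ => 2 * Real.pi * s) volume volume := by
    refine ⟨by fun_prop, ?_⟩
    have h := Real.map_volume_mul_left hpi
    rw [h]
    exact Measure.smul_absolutelyContinuous
  filter_upwards [hq.ae h1] with s hs
  rw [← ENNReal.ofReal_toReal hf.ne, ENNReal.ofReal_le_ofReal_iff ENNReal.toReal_nonneg] at hs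
  unfold transfer at hs
  rw [mul_div_cancel_left₀ _ hpi, norm_mul, mul_pow] at hs
  have h2 : ‖(((Real.sqrt (2 * Real.pi))⁻¹ : ℝ) : ℂ)‖ ^ 2 = (2 * Real.pi)⁻¹ := by
    rw [Complex.norm_real, Real.norm_eq_abs, sq_abs, inv_pow, Real.sq_sqrt (by positivity)]
  rw [h2, inv_mul_le_iff₀ (by positivity)] at hs
  exact hs

/-- Up to the reflection `s ↦ -s` this is Plancherel for `g` cut off to `[0, T]`. -/
theorem eLpNorm_integral_char {T : ℝ} (hT : 0 ≤ T) {g : ℝ → ℝ} (hg : ContinuousOn g (Icc 0 T)) :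
    eLpNorm (fun s => ∫ t in (0 : ℝ)..T, (g t : ℂ) * char t s) 2 volume =
      ENNReal.ofReal (Real.sqrt (∫ t in (0 : ℝ)..T, g t ^ 2)) := by
  set G : ℝ → ℂ := (Icc 0 T).indicator fun t => (g t : ℂ) with hG
  have hgc : ContinuousOn (fun t => (g t : ℂ)) (Icc 0 T) :=
    Complex.continuous_ofReal.comp_continuousOn hg
  have h1 : Integrable G := (hgc.integrableOn_Icc).integrable_indicator measurableSet_Icc
  have h2 : MemLp G 2 := by
    rw [hG, memLp_indicator_iff_restrict measurableSet_Icc]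
    obtain ⟨C, hC⟩ := isCompact_Icc.exists_bound_of_continuousOn hgc
    refine MemLp.of_bound (hgc.aestronglyMeasurable measurableSet_Icc) C ?_
    exact (ae_restrict_iff' measurableSet_Icc).2 (Eventually.of_forall hC)
  have h3 : (fun s => ∫ t in (0 : ℝ)..T, (g t : ℂ) * char t s) = 𝓕 G ∘ Neg.neg := by
    ext s
    rw [Function.comp, Real.fourier_eq', intervalIntegral.integral_of_le hT,
      ← integral_Icc_eq_integral_Ioc, ← integral_indicator measurableSet_Icc]
    refine integral_congr_ae (Eventually.of_forall fun t => ?_)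
    simp only [hG, indicator]
    split_ifs
    · rw [smul_eq_mul, mul_comm, char]
      congr 3
      simp only [RCLike.inner_apply, conj_trivial]
      congr 1
      ring
    · simp
  rw [h3, eLpNorm_comp_measurePreserving (p := 2) (f := Neg.neg) (g := 𝓕 G) (μ := volume)
    (ν := volume) ?_ (Measure.measurePreserving_neg (volume : Measure ℝ)),
    eLpNorm_fourier h1 h2]
  · have h4 : eLpNorm G 2 volume = eLpNorm g 2 (volume.restrict (Icc 0 T)) := by
      rw [hG, eLpNorm_indicator_eq_eLpNorm_restrict measurableSet_Icc]
      exact eLpNorm_congr_norm_ae (Eventually.of_forall fun t => by simp)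
    have h5 : MemLp g 2 (volume.restrict (Icc 0 T)) := by
      refine ⟨hg.aestronglyMeasurable measurableSet_Icc, ?_⟩
      rw [← h4]
      exact h2.2
    rw [h4, ← ENNReal.ofReal_toReal h5.2.ne, intervalIntegral.integral_of_le hT,
      ← integral_Icc_eq_integral_Ioc, ← sq_toReal_eLpNorm_two h5,
      Real.sqrt_sq ENNReal.toReal_nonneg]
  · exact (VectorFourier.fourierIntegral_continuous Real.continuous_fourierChar
      continuous_inner h1).aestronglyMeasurable

end Spectral

/-! ### Sub-Gaussianity of weighted integrals of the noise. -/

section LinearFunctional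

variable {Ω : Type*} [MeasurableSpace Ω] {P : Measure Ω} {ε ξ : ℝ → Ω → ℝ} {ψ : ℝ → ℝ}

/-- Passing to frequencies replaces translates of a merely square integrable `ψ` by continuous
characters. There the sums converge pointwise and are dominated by `C T ‖F‖`, so dominated
convergence applies. -/
theorem tendsto_eLpNorm_quad (hψ : MemLp ψ 2 volume) {T : ℝ} (hT : 0 ≤ T) {g : ℝ → ℝ}
    (hg : ContinuousOn g (Icc 0 T)) :
    Tendsto (fun n => eLpNorm (fun u => ∑ x ∈ (quadNodes T hT n).range,
        (quadWeight T hT n x * g x) * ψ (x - u)) 2 volume) atTop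
      (𝓝 (eLpNorm (fun s => (∫ t in (0 : ℝ)..T, (g t : ℂ) * char t s) *
        (𝓕 (MemLp.toLp (fun t => (ψ t : ℂ)) hψ.ofReal) : Lp ℂ 2 (volume : Measure ℝ)) s)
        2 volume)) := by
  set F := (𝓕 (MemLp.toLp (fun t => (ψ t : ℂ)) hψ.ofReal) : Lp ℂ 2 (volume : Measure ℝ)) with hF
  have hgc : ContinuousOn (fun t => (g t : ℂ)) (Icc 0 T) :=
    Complex.continuous_ofReal.comp_continuousOn hg
  obtain ⟨C, hC⟩ := isCompact_Icc.exists_bound_of_continuousOn hgc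
  have hch : ∀ s, Continuous fun t => char t s := fun s => by
    unfold char
    fun_prop
  have hlim : ∀ s, Tendsto (fun n => ∑ x ∈ (quadNodes T hT n).range,
      ((quadWeight T hT n x * g x : ℝ) : ℂ) * char x s) atTop
      (𝓝 (∫ t in (0 : ℝ)..T, (g t : ℂ) * char t s)) := by
    intro s
    have := tendsto_sum_quadWeight_smul T hT (F := fun t => (g t : ℂ) * char t s)
      (hgc.mul (hch s).continuousOn)
    simpa [mul_assoc] using this
  have hbd : ∀ n s, ‖∑ x ∈ (quadNodes T hT n).range,
      ((quadWeight T hT n x * g x : ℝ) : ℂ) * char x s‖ ≤ C * T := by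
    intro n s
    have := norm_sum_quadWeight_smul_le T hT n (F := fun t => (g t : ℂ) * char t s) (C := C)
      (fun t ht => by rw [norm_mul, norm_char, mul_one]; exact hC t ht)
    simpa [mul_assoc] using this
  have hrw : ∀ n, eLpNorm (fun u => ∑ x ∈ (quadNodes T hT n).range,
        (quadWeight T hT n x * g x) * ψ (x - u)) 2 volume =
      (∫⁻ s, ‖(∑ x ∈ (quadNodes T hT n).range,
        ((quadWeight T hT n x * g x : ℝ) : ℂ) * char x s) * F s‖ₑ ^ (2 : ℝ)) ^ (1 / 2 : ℝ) := by
    intro n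
    rw [eLpNorm_sum_translate hψ (quadNodes T hT n).range
      (fun x => quadWeight T hT n x * g x),
      eLpNorm_eq_lintegral_rpow_enorm_toReal (by norm_num) (by norm_num)]
    simp only [ENNReal.toReal_ofNat, Complex.ofReal_mul, hF]
  simp only [hrw]
  rw [eLpNorm_eq_lintegral_rpow_enorm_toReal (by norm_num) (by norm_num)]
  simp only [ENNReal.toReal_ofNat]
  refine (ENNReal.continuous_rpow_const.tendsto _).comp ?_
  have hFm := Lp.aestronglyMeasurable F
  refine tendsto_lintegral_of_dominated_convergence'
    (fun s => (ENNReal.ofReal (C * T) * ‖F s‖ₑ) ^ (2 : ℝ)) (fun n => ?_)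
    (fun n => Eventually.of_forall fun s => ?_) ?_ (Eventually.of_forall fun s => ?_)
  · refine AEMeasurable.pow_const (AEStronglyMeasurable.enorm ?_) _
    refine AEStronglyMeasurable.mul (Continuous.aestronglyMeasurable ?_) hFm
    exact continuous_finsetSum _ fun x _ => continuous_const.mul (contDiff_char x).continuous
  · dsimp only
    rw [enorm_mul]
    gcongr
    rw [← ofReal_norm]
    exact ENNReal.ofReal_le_ofReal (hbd n s)
  · have h1 := lintegral_rpow_enorm_lt_top_of_eLpNorm_lt_top (by norm_num) (by norm_num)
      (Lp.memLp F).2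
    simp only [ENNReal.toReal_ofNat] at h1
    simp only [ENNReal.mul_rpow_of_nonneg _ _ (by norm_num : (0 : ℝ) ≤ 2)]
    rw [lintegral_const_mul' _ _ (by simp)]
    exact (ENNReal.mul_lt_top (by simp) h1).ne
  · refine (ENNReal.continuous_rpow_const.tendsto _).comp ?_
    exact ((hlim s).mul_const (F s)).enorm

theorem aemeasurable_integral_mul (hε : IsCentredContinuousNoise P ε) {T : ℝ} (hT : 0 ≤ T)
    {g : ℝ → ℝ} (hg : ContinuousOn g (Icc 0 T)) :
    AEMeasurable (fun ω => ∫ t in (0 : ℝ)..T, ε t ω * g t) P := by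
  refine aemeasurable_of_tendsto_metrizable_ae atTop
    (f := fun n ω => ∑ x ∈ (quadNodes T hT n).range, quadWeight T hT n x • (ε x ω * g x))
    (fun n => ?_) ?_
  · refine Finset.aemeasurable_fun_sum _ fun x _ => ?_
    exact (((hε.measurable x).mul_const (g x)).const_mul (quadWeight T hT n x)).aemeasurable
  · filter_upwards [hε.ae_continuous] with ω hω
    exact tendsto_sum_quadWeight_smul T hT (hω.continuousOn.mul hg)

variable [IsProbabilityMeasure P]

/-- Quadrature sums of `ε g` are mean-square integrals of the kernels summed above. Fatou reduces
the claim to the limiting kernel norm, where `‖𝓕ψ‖² ≤ 2π f₀ ≤ V` almost everywhere comes out as a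
factor and Plancherel for `g` does the rest. -/
theorem lintegral_exp_integral_mul_le (hε : IsCentredContinuousNoise P ε)
    (hξ : IsIntegratedWhiteNoise P ξ) (hψ : MemLp ψ 2 volume)
    (hεξ : ∀ t, IsMeanSquareIntegral P ξ (fun s => ψ (t - s)) (ε t))
    (hf : spectralSup ψ hψ < ⊤) {V : ℝ} (hV : 2 * Real.pi * (spectralSup ψ hψ).toReal ≤ V)
    {T : ℝ} (hT : 0 ≤ T) {g : ℝ → ℝ} (hg : ContinuousOn g (Icc 0 T)) :
    ∫⁻ ω, ENNReal.ofReal (Real.exp (∫ t in (0 : ℝ)..T, ε t ω * g t)) ∂P ≤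
      ENNReal.ofReal (Real.exp ((1 / 2) * (V * ∫ t in (0 : ℝ)..T, g t ^ 2))) := by
  have hV0 : 0 ≤ V := le_trans (by positivity) hV
  have hm : ∀ t, MemLp (fun s => ψ (t - s)) 2 volume := fun t =>
    hψ.comp_measurePreserving (Measure.measurePreserving_sub_left volume t)
  set N := eLpNorm (fun s => (∫ t in (0 : ℝ)..T, (g t : ℂ) * char t s) *
        (𝓕 (MemLp.toLp (fun t => (ψ t : ℂ)) hψ.ofReal) : Lp ℂ 2 (volume : Measure ℝ)) s)
        2 volume with hN
  have hI : 0 ≤ ∫ t in (0 : ℝ)..T, g t ^ 2 :=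
    intervalIntegral.integral_nonneg hT fun t _ => sq_nonneg _
  have hNle : N ≤ ENNReal.ofReal (Real.sqrt (V * ∫ t in (0 : ℝ)..T, g t ^ 2)) := by
    rw [Real.sqrt_mul hV0, ENNReal.ofReal_mul (Real.sqrt_nonneg _), ← eLpNorm_integral_char hT hg]
    refine eLpNorm_le_mul_eLpNorm_of_ae_le_mul ?_ 2
    filter_upwards [ae_norm_fourier_sq_le hψ hf] with s hs
    rw [norm_mul, mul_comm]
    exact mul_le_mul_of_nonneg_right (Real.le_sqrt_of_sq_le (hs.trans hV)) (norm_nonneg _)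
  have hNt : N ≠ ∞ := (hNle.trans_lt ENNReal.ofReal_lt_top).ne
  have hlim := tendsto_eLpNorm_quad hψ hT hg
  set f : ℕ → ℝ → ℝ := fun n u => ∑ x ∈ (quadNodes T hT n).range,
    (quadWeight T hT n x * g x) * ψ (x - u) with hfdef
  set S : ℕ → Ω → ℝ := fun n ω => ∑ x ∈ (quadNodes T hT n).range,
    (quadWeight T hT n x * g x) * ε x ω with hS
  have hstep : ∀ n, ∫⁻ ω, ENNReal.ofReal (Real.exp (S n ω)) ∂P ≤
      ENNReal.ofReal (Real.exp ((1 / 2) * (eLpNorm (f n) 2 volume).toReal ^ 2)) := fun n =>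
    IsMeanSquareIntegral.lintegral_exp_le hξ
      (memLp_finsetSum _ fun x _ => (hm x).const_mul _)
      (IsMeanSquareIntegral.sum hξ _ _ (fun x => (hm x).1) fun x _ => hεξ x)
  have hlim2 : Tendsto (fun n => ENNReal.ofReal
      (Real.exp ((1 / 2) * (eLpNorm (f n) 2 volume).toReal ^ 2))) atTop
      (𝓝 (ENNReal.ofReal (Real.exp ((1 / 2) * N.toReal ^ 2)))) := by
    refine ENNReal.tendsto_ofReal ((Real.continuous_exp.tendsto _).comp
      (Tendsto.const_mul _ (Tendsto.pow ?_ 2)))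
    exact (ENNReal.tendsto_toReal hNt).comp hlim
  have hSlim : ∀ᵐ ω ∂P, Tendsto (fun n => S n ω) atTop
      (𝓝 (∫ t in (0 : ℝ)..T, ε t ω * g t)) := by
    filter_upwards [hε.ae_continuous] with ω hω
    refine (tendsto_sum_quadWeight_smul T hT (hω.continuousOn.mul hg)).congr fun n => ?_
    exact Finset.sum_congr rfl fun x _ => by simp only [smul_eq_mul, Pi.mul_apply]; ring
  calc ∫⁻ ω, ENNReal.ofReal (Real.exp (∫ t in (0 : ℝ)..T, ε t ω * g t)) ∂P
      = ∫⁻ ω, liminf (fun n => ENNReal.ofReal (Real.exp (S n ω))) atTop ∂P := by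
        refine lintegral_congr_ae ?_
        filter_upwards [hSlim] with ω hω
        exact (ENNReal.tendsto_ofReal ((Real.continuous_exp.tendsto _).comp hω)).liminf_eq.symm
    _ ≤ liminf (fun n => ∫⁻ ω, ENNReal.ofReal (Real.exp (S n ω)) ∂P) atTop := by
        refine lintegral_liminf_le fun n => (Real.measurable_exp.comp ?_).ennreal_ofReal
        exact Finset.measurable_fun_sum _ fun x _ => (hε.measurable x).const_mul _
    _ ≤ liminf (fun n => ENNReal.ofReal
          (Real.exp ((1 / 2) * (eLpNorm (f n) 2 volume).toReal ^ 2))) atTop :=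
        liminf_le_liminf (Eventually.of_forall hstep)
    _ = ENNReal.ofReal (Real.exp ((1 / 2) * N.toReal ^ 2)) := hlim2.liminf_eq
    _ ≤ _ := by
        refine ENNReal.ofReal_le_ofReal (Real.exp_le_exp.2 ?_)
        have h1 : N.toReal ≤ Real.sqrt (V * ∫ t in (0 : ℝ)..T, g t ^ 2) :=
          ENNReal.toReal_le_of_le_ofReal (Real.sqrt_nonneg _) hNle
        have h2 := pow_le_pow_left₀ ENNReal.toReal_nonneg h1 2
        rw [Real.sq_sqrt (mul_nonneg hV0 hI)] at h2
        linarith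

theorem hasSubgaussianMGF_integral_mul (hε : IsCentredContinuousNoise P ε)
    (hξ : IsIntegratedWhiteNoise P ξ) (hψ : MemLp ψ 2 volume)
    (hεξ : ∀ t, IsMeanSquareIntegral P ξ (fun s => ψ (t - s)) (ε t))
    (hf : spectralSup ψ hψ < ⊤) {V : ℝ} (hV : 2 * Real.pi * (spectralSup ψ hψ).toReal ≤ V)
    {T : ℝ} (hT : 0 ≤ T) {g : ℝ → ℝ} (hg : ContinuousOn g (Icc 0 T)) :
    ProbabilityTheory.HasSubgaussianMGF (fun ω => ∫ t in (0 : ℝ)..T, ε t ω * g t)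
      (V * ∫ t in (0 : ℝ)..T, g t ^ 2).toNNReal P := by
  have hV0 : 0 ≤ V := le_trans (by positivity) hV
  have hI : 0 ≤ ∫ t in (0 : ℝ)..T, g t ^ 2 :=
    intervalIntegral.integral_nonneg hT fun t _ => sq_nonneg _
  have hm : ∀ r : ℝ, AEStronglyMeasurable
      (fun ω => Real.exp (r * ∫ t in (0 : ℝ)..T, ε t ω * g t)) P := fun r =>
    (Real.measurable_exp.comp_aemeasurable
      ((aemeasurable_integral_mul hε hT hg).const_mul r)).aestronglyMeasurable
  have key : ∀ r : ℝ, ∫⁻ ω, ENNReal.ofReal (Real.exp (r * ∫ t in (0 : ℝ)..T, ε t ω * g t)) ∂P ≤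
      ENNReal.ofReal (Real.exp ((V * ∫ t in (0 : ℝ)..T, g t ^ 2).toNNReal * r ^ 2 / 2)) := by
    intro r
    have := lintegral_exp_integral_mul_le hε hξ hψ hεξ hf hV hT (g := fun t => r * g t)
      (continuousOn_const.mul hg)
    have h1 : ∀ ω, ∫ t in (0 : ℝ)..T, ε t ω * (r * g t) =
        r * ∫ t in (0 : ℝ)..T, ε t ω * g t := fun ω => by
      rw [← intervalIntegral.integral_const_mul]
      exact intervalIntegral.integral_congr fun t _ => by ring
    simp only [h1, mul_pow, intervalIntegral.integral_const_mul] at this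
    refine this.trans_eq ?_
    rw [Real.coe_toNNReal _ (mul_nonneg hV0 hI)]
    congr 2
    ring
  refine ⟨fun r => ⟨hm r, ?_⟩, fun r => ?_⟩
  · rw [hasFiniteIntegral_iff_ofReal (Eventually.of_forall fun ω => Real.exp_nonneg _)]
    exact (key r).trans_lt ENNReal.ofReal_lt_top
  · rw [ProbabilityTheory.mgf, integral_eq_lintegral_of_nonneg_ae
      (Eventually.of_forall fun ω => Real.exp_nonneg _) (hm r)]
    exact ENNReal.toReal_le_of_le_ofReal (Real.exp_nonneg _) (key r)

end LinearFunctional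

/-! ### Monomial expansion of the difference quotient. -/

section Expansion

theorem abs_prod_sub_prod_le {n : ℕ} {a b : Fin (n + 1) → ℝ} {D δ : ℝ}
    (ha : ∀ l, |a l| ≤ D) (hb : ∀ l, |b l| ≤ D) (hab : ∀ l, |a l - b l| ≤ δ) :
    |∏ l, a l - ∏ l, b l| ≤ (n + 1) * D ^ n * δ := by
  have hD : 0 ≤ D := (abs_nonneg _).trans (ha 0)
  have hδ : 0 ≤ δ := (abs_nonneg _).trans (hab 0)
  induction n with
  | zero => simpa using hab 0
  | succ n ih =>
    rw [Fin.prod_univ_succ a, Fin.prod_univ_succ b]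
    have h1 := ih (fun l => ha l.succ) (fun l => hb l.succ) (fun l => hab l.succ)
    have h2 : |∏ l : Fin (n + 1), b l.succ| ≤ D ^ (n + 1) := by
      rw [Finset.abs_prod]
      exact (Finset.prod_le_prod (fun _ _ => abs_nonneg _)
        fun (l : Fin (n + 1)) _ => hb l.succ).trans_eq (by simp)
    have h3 : a 0 * ∏ l : Fin (n + 1), a l.succ - b 0 * ∏ l : Fin (n + 1), b l.succ =
        a 0 * (∏ l : Fin (n + 1), a l.succ - ∏ l : Fin (n + 1), b l.succ) +
          (a 0 - b 0) * ∏ l : Fin (n + 1), b l.succ := by ring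
    rw [h3]
    refine (abs_add_le _ _).trans ?_
    rw [abs_mul, abs_mul]
    calc _ ≤ D * ((n + 1) * D ^ n * δ) + δ * D ^ (n + 1) := by
          gcongr
          · exact ha 0
          · exact hab 0
      _ = _ := by push_cast; ring

variable {q : ℕ}

/-- The monomial `∏ₗ z (i l)`. -/
def monomial (z : EuclideanSpace ℝ (Fin q)) (k : ℕ) (i : Fin (k + 1) → Fin q) : ℝ := ∏ l, z (i l)

/-- The coefficients of the expansion of `(exp ⟨v, z⟩ - 1) / ‖v‖` in monomials of `z`. -/
noncomputable def coef (v : EuclideanSpace ℝ (Fin q)) (k : ℕ) (i : Fin (k + 1) → Fin q) : ℝ :=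
  (∏ l, (if l = 0 then ‖v‖⁻¹ • v else v) (i l)) / (k + 1).factorial

/-- The difference quotient `(exp ⟨θ + v, z⟩ - exp ⟨θ, z⟩) / ‖v‖`. -/
noncomputable def diffQuot (θ v z : EuclideanSpace ℝ (Fin q)) : ℝ :=
  (Real.exp (inner ℝ (θ + v) z) - Real.exp (inner ℝ θ z)) / ‖v‖

theorem sum_coef_mul_monomial (v z : EuclideanSpace ℝ (Fin q)) (k : ℕ) :
    ∑ i, coef v k i * monomial z k i =
      ‖v‖⁻¹ * inner ℝ v z ^ (k + 1) / (k + 1).factorial := by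
  have h : ∀ u : EuclideanSpace ℝ (Fin q), ∑ j, u j * z j = inner ℝ u z := fun u => by
    simp [PiLp.inner_apply, mul_comm]
  simp only [coef, monomial, div_mul_eq_mul_div, ← Finset.prod_mul_distrib, ← Finset.sum_div]
  congr 1
  have := Finset.prod_univ_sum (fun _ : Fin (k + 1) => (Finset.univ : Finset (Fin q)))
    (fun l j => (if l = 0 then ‖v‖⁻¹ • v else v) j * z j)
  rw [Fintype.piFinset_univ] at this
  rw [← this]
  simp only [h]
  rw [Fin.prod_univ_succ]
  simp only [if_true, Fin.succ_ne_zero, if_false, Finset.prod_const, Finset.card_univ,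
    Fintype.card_fin, real_inner_smul_left]
  ring

theorem hasSum_diffQuot (θ v z : EuclideanSpace ℝ (Fin q)) :
    HasSum (fun k => ∑ i, coef v k i * (Real.exp (inner ℝ θ z) * monomial z k i))
      (diffQuot θ v z) := by
  have h1 : HasSum (fun k : ℕ => inner ℝ v z ^ k / (k.factorial : ℝ)) (Real.exp (inner ℝ v z)) := by
    rw [Real.exp_eq_exp_ℝ]
    exact NormedSpace.expSeries_div_hasSum_exp _
  have h2 := (hasSum_nat_add_iff' 1).2 h1
  have h3 := h2.mul_left (Real.exp (inner ℝ θ z) * ‖v‖⁻¹)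
  convert! h3 using 1
  · ext k
    simp only [mul_left_comm _ (Real.exp (inner ℝ θ z)), ← Finset.mul_sum,
      sum_coef_mul_monomial]
    ring
  · rw [diffQuot, inner_add_left, Real.exp_add]
    simp
    ring

/-- Dividing by `‖v‖` normalizes exactly one of the `k + 1` factors, so the coefficient is a product
depending on `(v/‖v‖, v)`. Telescoping costs a factor `k + 1`, which lowers `(k+1)!` to `k!`. -/
theorem abs_coef_sub_le {v w : EuclideanSpace ℝ (Fin q)} {D δ : ℝ} (hD : 1 ≤ D)
    (hv : ‖v‖ ≤ D) (hw : ‖w‖ ≤ D) (h1 : ‖‖v‖⁻¹ • v - ‖w‖⁻¹ • w‖ ≤ δ) (h2 : ‖v - w‖ ≤ δ)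
    (k : ℕ) (i : Fin (k + 1) → Fin q) :
    |coef v k i - coef w k i| ≤ δ * (D ^ k / k.factorial) := by
  have hap : ∀ (u : EuclideanSpace ℝ (Fin q)) j, |u j| ≤ ‖u‖ := fun u j =>
    PiLp.norm_apply_le u j
  have hn : ∀ u : EuclideanSpace ℝ (Fin q), ‖u‖ ≤ D → ∀ l : Fin (k + 1),
      |(if l = 0 then ‖u‖⁻¹ • u else u) (i l)| ≤ D := by
    intro u hu l
    refine (hap _ _).trans ?_
    split_ifs
    · rw [norm_smul, norm_inv, norm_norm]
      exact inv_mul_le_one.trans hD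
    · exact hu
  rw [coef, coef, ← sub_div, abs_div, Nat.abs_cast]
  have h3 := abs_prod_sub_prod_le (hn v hv) (hn w hw) (δ := δ) fun l => by
    split_ifs
    · exact (hap (‖v‖⁻¹ • v - ‖w‖⁻¹ • w) _).trans h1
    · exact (hap (v - w) _).trans h2
  rw [div_le_iff₀ (by positivity), Nat.factorial_succ]
  refine h3.trans_eq ?_
  push_cast
  field_simp

theorem abs_monomial_le {z : EuclideanSpace ℝ (Fin q)} {C : ℝ} (hz : ‖z‖ ≤ C) (k : ℕ)
    (i : Fin (k + 1) → Fin q) : |monomial z k i| ≤ C ^ (k + 1) := by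
  rw [monomial, Finset.abs_prod]
  exact (Finset.prod_le_prod (fun _ _ => abs_nonneg _)
    fun (l : Fin (k + 1)) _ => (PiLp.norm_apply_le z (i l)).trans hz).trans_eq (by simp)

/-- The weights that bound the increments of the expansion, see `abs_sub_le_of_hasSum`. -/
noncomputable def incrWeight (q : ℕ) (D E C : ℝ) (k : ℕ) : ℝ :=
  q ^ (k + 1) * (D ^ k / k.factorial * ((k + 1) * (E * C ^ (k + 1))))

theorem summable_incrWeight (q : ℕ) {D E C : ℝ} : Summable (incrWeight q D E C) := by
  have h1 : Summable fun k : ℕ => (k : ℝ) * ((q * D * C) ^ k / k.factorial) := by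
    rw [← summable_nat_add_iff 1]
    refine ((Real.summable_pow_div_factorial (q * D * C)).mul_left (q * D * C)).congr fun k => ?_
    rw [Nat.factorial_succ]
    push_cast
    field_simp
    ring
  have h2 := (h1.add (Real.summable_pow_div_factorial (q * D * C))).mul_left (q * E * C)
  refine h2.congr fun k => ?_
  rw [incrWeight]
  ring

/-- Serves two expansions with the same coefficients: the difference quotient itself, with `b = 1`,
and the noise functional off the exceptional event, with `b` of order `√T R`. The extra factor `k +
1` in `hM` is needed for the latter and is harmless next to `k!`. -/
theorem abs_sub_le_of_hasSum {c c' M : (k : ℕ) → (Fin (k + 1) → Fin q) → ℝ} {S S' : ℝ}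
    {D E C δ b : ℝ} (h : HasSum (fun k => ∑ i, c k i * M k i) S)
    (h' : HasSum (fun k => ∑ i, c' k i * M k i) S')
    (hc : ∀ k i, |c k i - c' k i| ≤ δ * (D ^ k / k.factorial))
    (hM : ∀ k i, |M k i| ≤ b * ((k + 1) * (E * C ^ (k + 1)))) :
    |S - S'| ≤ δ * b * ∑' k, incrWeight q D E C k := by
  have h1 := h.sub h'
  have h2 := ((summable_incrWeight q (D := D) (E := E) (C := C)).hasSum).mul_left (δ * b)
  rw [← Real.norm_eq_abs, ← h1.tsum_eq]
  refine tsum_of_norm_bounded h2 fun k => ?_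
  rw [← Finset.sum_sub_distrib, Real.norm_eq_abs]
  refine (Finset.abs_sum_le_sum_abs _ _).trans ?_
  calc _ ≤ ∑ _i : Fin (k + 1) → Fin q,
        (δ * (D ^ k / k.factorial)) * (b * ((k + 1) * (E * C ^ (k + 1)))) := by
        refine Finset.sum_le_sum fun i _ => ?_
        rw [← sub_mul, abs_mul]
        exact mul_le_mul (hc k i) (hM k i) (abs_nonneg _) ((abs_nonneg _).trans (hc k i))
    _ = _ := by
        simp [incrWeight]
        ring

end Expansion

/-! ### Lower bounds for the signal and the basic inequality. -/

section Deterministic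

variable {q : ℕ}

theorem leastEigenvalue_mul_le {J : Matrix (Fin q) (Fin q) ℝ} (hJ : J.IsHermitian)
    (x : EuclideanSpace ℝ (Fin q)) :
    leastEigenvalue J hJ * ‖x‖ ^ 2 ≤ ∑ i, ∑ j, J i j * (x i * x j) := by
  have h1 : ∑ i, ∑ j, J i j * (x i * x j) = inner ℝ x (WithLp.toLp 2 (J.mulVec x)) := by
    simp only [PiLp.inner_apply, Matrix.mulVec, dotProduct, RCLike.inner_apply, conj_trivial,
      Finset.sum_mul]
    exact Finset.sum_congr rfl fun i _ => Finset.sum_congr rfl fun j _ => by ring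
  have h2 : ∀ k, inner ℝ (hJ.eigenvectorBasis k) (WithLp.toLp 2 (J.mulVec x)) =
      hJ.eigenvalues k * inner ℝ (hJ.eigenvectorBasis k) x := by
    intro k
    have h3 := hJ.mulVec_eigenvectorBasis k
    have h4 : inner ℝ (hJ.eigenvectorBasis k) (WithLp.toLp 2 (J.mulVec x)) =
        dotProduct (J.mulVec (hJ.eigenvectorBasis k)) x := by
      rw [EuclideanSpace.inner_eq_star_dotProduct]
      simp only [star_trivial]
      rw [dotProduct_comm, Matrix.dotProduct_mulVec, ← Matrix.mulVec_transpose]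
      congr 2
    rw [h4, h3, smul_dotProduct, EuclideanSpace.inner_eq_star_dotProduct, dotProduct_comm]
    simp
  rw [h1, ← hJ.eigenvectorBasis.sum_inner_mul_inner x, ← real_inner_self_eq_norm_sq,
    ← hJ.eigenvectorBasis.sum_inner_mul_inner x, Finset.mul_sum]
  refine Finset.sum_le_sum fun k _ => ?_
  rw [h2, real_inner_comm x]
  have h5 : leastEigenvalue J hJ ≤ hJ.eigenvalues k := ciInf_le (finite_range _).bddBelow k
  nlinarith [mul_self_nonneg (inner ℝ (hJ.eigenvectorBasis k) x)]

theorem leastEigenvalue_pos (hq : 1 ≤ q) {J : Matrix (Fin q) (Fin q) ℝ} (hJ : J.PosDef) :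
    0 < leastEigenvalue J hJ.isHermitian := by
  have : Nonempty (Fin q) := ⟨⟨0, hq⟩⟩
  obtain ⟨k, hk⟩ := exists_eq_ciInf_of_finite (f := fun i => hJ.isHermitian.eigenvalues i)
  rw [leastEigenvalue, ← hk]
  exact hJ.eigenvalues_pos k

theorem intervalIntegrable_of_continuousOn_Icc {T : ℝ} (hT : 0 ≤ T) {f : ℝ → ℝ}
    (hf : ContinuousOn f (Icc 0 T)) : IntervalIntegrable f volume 0 T :=
  ContinuousOn.intervalIntegrable (by rwa [uIcc_of_le hT])

theorem integral_inner_sq {y : ℝ → EuclideanSpace ℝ (Fin q)} {T : ℝ} (hT : 0 < T)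
    (hy : ContinuousOn y (Icc 0 T)) (x : EuclideanSpace ℝ (Fin q)) :
    ∫ t in (0 : ℝ)..T, inner ℝ x (y t) ^ 2 =
      T * ∑ i, ∑ j, gramAverage y T i j * (x i * x j) := by
  have hyc : ∀ i, ContinuousOn (fun t => y t i) (Icc 0 T) := fun i =>
    (EuclideanSpace.proj (𝕜 := ℝ) i).continuous.comp_continuousOn hy
  have h1 : ∀ t, inner ℝ x (y t) ^ 2 = ∑ i, ∑ j, (y t i * y t j) * (x i * x j) := by
    intro t
    simp only [PiLp.inner_apply, RCLike.inner_apply, conj_trivial, sq, Finset.sum_mul_sum]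
    exact Finset.sum_congr rfl fun i _ => Finset.sum_congr rfl fun j _ => by ring
  have hint : ∀ i j, IntervalIntegrable (fun t => (y t i * y t j) * (x i * x j)) volume 0 T :=
    fun i j => intervalIntegrable_of_continuousOn_Icc hT.le
      (((hyc i).mul (hyc j)).mul continuousOn_const)
  simp only [h1]
  rw [intervalIntegral.integral_finsetSum fun i _ => by
    simpa only [Finset.sum_fn] using IntervalIntegrable.sum _ fun j _ => hint i j, Finset.mul_sum]
  refine Finset.sum_congr rfl fun i _ => ?_
  rw [intervalIntegral.integral_finsetSum fun j _ => hint i j, Finset.mul_sum]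
  refine Finset.sum_congr rfl fun j _ => ?_
  rw [intervalIntegral.integral_mul_const, gramAverage, Matrix.of_apply]
  field_simp

/-- Entrywise convergence perturbs the quadratic form by a small multiple of `‖x‖²`, uniformly in
`x`. One eighth of the least eigenvalue is given away for this. -/
theorem exists_forall_le_integral_inner_sq (hq : 1 ≤ q) {y : ℝ → EuclideanSpace ℝ (Fin q)}
    (hy : ContinuousOn y (Ici 0)) {J : Matrix (Fin q) (Fin q) ℝ} (hJ : J.PosDef)
    (hJlim : Tendsto (gramAverage y) atTop (𝓝 J)) :
    ∃ T₀ > 0, ∀ T > T₀, ∀ x : EuclideanSpace ℝ (Fin q),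
      T * (7 / 8 * leastEigenvalue J hJ.isHermitian) * ‖x‖ ^ 2 ≤
        ∫ t in (0 : ℝ)..T, inner ℝ x (y t) ^ 2 := by
  set lam := leastEigenvalue J hJ.isHermitian with hlam
  have hlpos : 0 < lam := leastEigenvalue_pos hq hJ
  have hq0 : (0 : ℝ) < q := by exact_mod_cast hq
  -- The `q` in the denominator pays for `(∑ |x i|)² ≤ q ‖x‖²`.
  have hev : ∀ᶠ T in atTop, ∀ i j, |gramAverage y T i j - J i j| < lam / (8 * q) := by
    refine eventually_all.2 fun i => eventually_all.2 fun j => ?_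
    have h1 : Tendsto (fun T => gramAverage y T i j) atTop (𝓝 (J i j)) :=
      ((continuous_apply_apply i j).tendsto J).comp hJlim
    have hpos : 0 < lam / (8 * q) := by positivity
    exact (Metric.tendsto_nhds.1 h1 _ hpos).mono fun T hT => by rwa [Real.dist_eq] at hT
  obtain ⟨T₁, hT₁⟩ := eventually_atTop.1 hev
  refine ⟨max T₁ 1, by positivity, fun T hT x => ?_⟩
  have hT0 : 0 < T := lt_trans (by positivity) hT
  rw [integral_inner_sq hT0 (hy.mono Icc_subset_Ici_self), mul_assoc]
  refine mul_le_mul_of_nonneg_left ?_ hT0.le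
  have h2 := leastEigenvalue_mul_le hJ.isHermitian x
  have h3 : ∑ i, ∑ j, J i j * (x i * x j) - ∑ i, ∑ j, gramAverage y T i j * (x i * x j) ≤
      lam / 8 * ‖x‖ ^ 2 := by
    calc _ = ∑ i, ∑ j, (J i j - gramAverage y T i j) * (x i * x j) := by
          simp only [← Finset.sum_sub_distrib, sub_mul]
      _ ≤ ∑ i, ∑ j, lam / (8 * q) * (|x i| * |x j|) := by
          refine Finset.sum_le_sum fun i _ => Finset.sum_le_sum fun j _ => ?_
          refine (le_abs_self _).trans ?_
          rw [abs_mul, abs_mul, abs_sub_comm]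
          exact mul_le_mul_of_nonneg_right (hT₁ T ((le_max_left _ _).trans hT.le) i j).le
            (by positivity)
      _ = lam / (8 * q) * (∑ i, |x i|) ^ 2 := by
          rw [sq, Finset.sum_mul_sum]
          simp only [Finset.mul_sum]
      _ ≤ lam / (8 * q) * (q * ∑ i, |x i| ^ 2) := by
          refine mul_le_mul_of_nonneg_left ?_ (by positivity)
          simpa using sq_sum_le_card_mul_sum_sq (s := (Finset.univ : Finset (Fin q)))
            (f := fun i => |x i|)
      _ = _ := by
          rw [EuclideanSpace.norm_sq_eq]
          simp only [Real.norm_eq_abs]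
          field_simp
  rw [← hlam] at h2
  linarith

theorem sq_mul_sq_sub_le_exp {L a b : ℝ} (hL : 0 ≤ L) (ha : L ≤ Real.exp a)
    (hb : L ≤ Real.exp b) : L ^ 2 * (a - b) ^ 2 ≤ (Real.exp a - Real.exp b) ^ 2 := by
  have key : ∀ {a b : ℝ}, L ≤ Real.exp b → b ≤ a → L * (a - b) ≤ Real.exp a - Real.exp b := by
    intro a b hb hab
    have h1 : Real.exp a = Real.exp b * Real.exp (a - b) := by
      rw [← Real.exp_add]
      ring_nf
    have h2 := Real.add_one_le_exp (a - b)
    have h3 := Real.exp_pos b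
    nlinarith
  rw [← mul_pow]
  rcases le_total b a with h | h
  · exact pow_le_pow_left₀ (mul_nonneg hL (by linarith)) (key hb h) 2
  · rw [← neg_sq (L * (a - b)), ← neg_sq (Real.exp a - Real.exp b)]
    refine pow_le_pow_left₀ ?_ ?_ 2
    · nlinarith
    · linarith [key ha h]

theorem minExp_le {Y Θ : Set (EuclideanSpace ℝ (Fin q))} {z τ : EuclideanSpace ℝ (Fin q)}
    (hz : z ∈ Y) (hτ : τ ∈ closure Θ) : minExp Y Θ ≤ Real.exp (inner ℝ τ z) := by
  refine csInf_le ⟨0, ?_⟩ ⟨z, hz, τ, hτ, by rw [real_inner_comm]⟩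
  rintro _ ⟨_, _, _, _, rfl⟩
  exact (Real.exp_pos _).le

theorem minExp_pos {Y Θ : Set (EuclideanSpace ℝ (Fin q))} {C C' : ℝ} (hY : ∀ z ∈ Y, ‖z‖ ≤ C)
    (hΘ : ∀ τ ∈ closure Θ, ‖τ‖ ≤ C') (hYn : Y.Nonempty) (hΘn : Θ.Nonempty) :
    0 < minExp Y Θ := by
  obtain ⟨z, hz⟩ := hYn
  obtain ⟨τ, hτ⟩ := hΘn
  refine (Real.exp_pos (-(C * C'))).trans_le (le_csInf ⟨_, z, hz, τ, subset_closure hτ, rfl⟩ ?_)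
  rintro _ ⟨z, hz, τ, hτ, rfl⟩
  refine Real.exp_le_exp.2 (neg_le_of_abs_le ((abs_real_inner_le_norm _ _).trans ?_))
  exact mul_le_mul (hY z hz) (hΘ τ hτ) (norm_nonneg _) ((norm_nonneg _).trans (hY z hz))

theorem continuousOn_diffQuot {y : ℝ → EuclideanSpace ℝ (Fin q)} {s : Set ℝ}
    (hy : ContinuousOn y s) (θ v : EuclideanSpace ℝ (Fin q)) :
    ContinuousOn (fun t => diffQuot θ v (y t)) s := by
  unfold diffQuot
  fun_prop

theorem le_integral_diffQuot_sq {y : ℝ → EuclideanSpace ℝ (Fin q)} {T L m : ℝ} (hT : 0 ≤ T)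
    (hy : ContinuousOn y (Icc 0 T)) {θ v : EuclideanSpace ℝ (Fin q)} (hv : v ≠ 0) (hL : 0 ≤ L)
    (h1 : ∀ t ∈ Icc 0 T, L ≤ Real.exp (inner ℝ θ (y t)))
    (h2 : ∀ t ∈ Icc 0 T, L ≤ Real.exp (inner ℝ (θ + v) (y t)))
    (hm : T * m * ‖v‖ ^ 2 ≤ ∫ t in (0 : ℝ)..T, inner ℝ v (y t) ^ 2) :
    T * (L ^ 2 * m) ≤ ∫ t in (0 : ℝ)..T, diffQuot θ v (y t) ^ 2 := by
  have hv0 : 0 < ‖v‖ := norm_pos_iff.2 hv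
  have h3 : ∫ t in (0 : ℝ)..T, (L ^ 2 / ‖v‖ ^ 2) * inner ℝ v (y t) ^ 2 ≤
      ∫ t in (0 : ℝ)..T, diffQuot θ v (y t) ^ 2 := by
    refine intervalIntegral.integral_mono_on hT
      (intervalIntegrable_of_continuousOn_Icc hT (by fun_prop))
      (intervalIntegrable_of_continuousOn_Icc hT ((continuousOn_diffQuot hy θ v).pow 2))
      fun t ht => ?_
    have h4 := sq_mul_sq_sub_le_exp hL (h2 t ht) (h1 t ht)
    rw [inner_add_left, add_sub_cancel_left, ← inner_add_left] at h4
    rw [diffQuot, div_pow, div_mul_eq_mul_div]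
    gcongr
  rw [intervalIntegral.integral_const_mul] at h3
  refine le_trans ?_ h3
  calc T * (L ^ 2 * m) = L ^ 2 / ‖v‖ ^ 2 * (T * m * ‖v‖ ^ 2) := by field_simp
    _ ≤ _ := by gcongr

/-- Expanding the square cancels `∫ e²`, and one factor `‖v‖` divides out of what remains. -/
theorem norm_mul_integral_sq_le_of_lsFunctional_le {y : ℝ → EuclideanSpace ℝ (Fin q)} {T : ℝ}
    (hT : 0 ≤ T) (hy : ContinuousOn y (Icc 0 T)) {e : ℝ → ℝ} (he : ContinuousOn e (Icc 0 T))
    {θ v : EuclideanSpace ℝ (Fin q)} (hv : v ≠ 0)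
    (h : lsFunctional (expRegression y) (fun t => expRegression y t θ + e t) T (θ + v) ≤
      lsFunctional (expRegression y) (fun t => expRegression y t θ + e t) T θ) :
    ‖v‖ * ∫ t in (0 : ℝ)..T, diffQuot θ v (y t) ^ 2 ≤
      2 * ∫ t in (0 : ℝ)..T, e t * diffQuot θ v (y t) := by
  have hv0 : 0 < ‖v‖ := norm_pos_iff.2 hv
  have hd := continuousOn_diffQuot hy θ v
  have i1 : IntervalIntegrable (fun t => e t ^ 2) volume 0 T :=
    intervalIntegrable_of_continuousOn_Icc hT (he.pow 2)
  have i2 : IntervalIntegrable (fun t => e t * diffQuot θ v (y t)) volume 0 T :=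
    intervalIntegrable_of_continuousOn_Icc hT (he.mul hd)
  have i3 : IntervalIntegrable (fun t => diffQuot θ v (y t) ^ 2) volume 0 T :=
    intervalIntegrable_of_continuousOn_Icc hT (hd.pow 2)
  have h1 : ∀ t, (expRegression y t θ + e t - expRegression y t (θ + v)) ^ 2 =
      e t ^ 2 - (2 * ‖v‖) * (e t * diffQuot θ v (y t)) + ‖v‖ ^ 2 * diffQuot θ v (y t) ^ 2 := by
    intro t
    have : expRegression y t (θ + v) = expRegression y t θ + ‖v‖ * diffQuot θ v (y t) := by
      rw [expRegression, expRegression, diffQuot]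
      field_simp
      ring
    rw [this]
    ring
  simp only [lsFunctional, h1, add_sub_cancel_left] at h
  rw [intervalIntegral.integral_add (i1.sub (i2.const_mul _)) (i3.const_mul _),
    intervalIntegral.integral_sub i1 (i2.const_mul _), intervalIntegral.integral_const_mul,
    intervalIntegral.integral_const_mul] at h
  refine le_of_mul_le_mul_left ?_ hv0
  linarith

/-- Expansion of a linear functional of the difference quotient. -/
theorem hasSum_integral_mul_diffQuot {y : ℝ → EuclideanSpace ℝ (Fin q)} {T : ℝ} (hT : 0 ≤ T)
    (hy : ContinuousOn y (Icc 0 T)) {e : ℝ → ℝ} (he : ContinuousOn e (Icc 0 T))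
    (θ v : EuclideanSpace ℝ (Fin q)) :
    HasSum (fun k => ∑ i, coef v k i * ∫ t in (0 : ℝ)..T,
        e t * (Real.exp (inner ℝ θ (y t)) * monomial (y t) k i))
      (∫ t in (0 : ℝ)..T, e t * diffQuot θ v (y t)) := by
  have hexp : ContinuousOn (fun t => Real.exp (inner ℝ θ (y t))) (Icc 0 T) := by fun_prop
  have hmon : ∀ k i, ContinuousOn (fun t => monomial (y t) k i) (Icc 0 T) := fun k i => by
    unfold monomial
    exact continuousOn_finsetProd _ fun l _ =>
      (EuclideanSpace.proj (𝕜 := ℝ) (i l)).continuous.comp_continuousOn hy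
  have hterm : ∀ k i, ContinuousOn (fun t => coef v k i *
      (e t * (Real.exp (inner ℝ θ (y t)) * monomial (y t) k i))) (Icc 0 T) := fun k i =>
    continuousOn_const.mul (he.mul (hexp.mul (hmon k i)))
  have hsumc : ∀ k, ContinuousOn (fun t => ∑ i, coef v k i *
      (e t * (Real.exp (inner ℝ θ (y t)) * monomial (y t) k i))) (Icc 0 T) := fun k =>
    continuousOn_finsetSum _ fun i _ => hterm k i
  have hswap : ∀ k, ∑ i, coef v k i * ∫ t in (0 : ℝ)..T,
        e t * (Real.exp (inner ℝ θ (y t)) * monomial (y t) k i) =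
      ∫ t in (0 : ℝ)..T, ∑ i, coef v k i *
        (e t * (Real.exp (inner ℝ θ (y t)) * monomial (y t) k i)) := by
    intro k
    rw [intervalIntegral.integral_finsetSum fun i _ =>
      intervalIntegrable_of_continuousOn_Icc hT (hterm k i)]
    simp only [intervalIntegral.integral_const_mul]
  simp only [hswap]
  obtain ⟨B, hB⟩ := isCompact_Icc.exists_bound_of_continuousOn (he.mul hexp)
  obtain ⟨C, hC⟩ := isCompact_Icc.exists_bound_of_continuousOn
    (f := fun t => (inner ℝ v (y t) : ℝ)) (s := Icc 0 T) (by fun_prop)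
  have hB0 : 0 ≤ B := (norm_nonneg _).trans (hB 0 (left_mem_Icc.2 hT))
  have hC0 : 0 ≤ C := (norm_nonneg _).trans (hC 0 (left_mem_Icc.2 hT))
  have hsub : ∀ t ∈ uIoc 0 T, t ∈ Icc 0 T := fun t ht => by
    rw [uIoc_of_le hT] at ht
    exact Ioc_subset_Icc_self ht
  -- The exponential series dominates the terms uniformly on `[0, T]` for a fixed path, which
  -- justifies integrating term by term.
  have hsm : Summable fun k : ℕ => B * (‖v‖⁻¹ * (C ^ (k + 1) / (k + 1).factorial)) :=
    (((summable_nat_add_iff 1).2 (Real.summable_pow_div_factorial C)).mul_left _).mul_left _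
  refine intervalIntegral.hasSum_integral_of_dominated_convergence
    (fun k _ => B * (‖v‖⁻¹ * (C ^ (k + 1) / (k + 1).factorial))) (fun k => ?_)
    (fun k => Eventually.of_forall fun t ht => ?_) (Eventually.of_forall fun t _ => hsm)
    (by simp) (Eventually.of_forall fun t ht => ?_)
  · rw [uIoc_of_le hT]
    exact ((hsumc k).mono Ioc_subset_Icc_self).aestronglyMeasurable measurableSet_Ioc
  · have h1 : ∑ i, coef v k i * (e t * (Real.exp (inner ℝ θ (y t)) * monomial (y t) k i)) =
        (e t * Real.exp (inner ℝ θ (y t))) *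
          (‖v‖⁻¹ * inner ℝ v (y t) ^ (k + 1) / (k + 1).factorial) := by
      rw [← sum_coef_mul_monomial, Finset.mul_sum]
      exact Finset.sum_congr rfl fun i _ => by ring
    rw [h1, norm_mul]
    refine mul_le_mul (hB t (hsub t ht)) ?_ (norm_nonneg _) hB0
    rw [mul_div_assoc, norm_mul, norm_inv, norm_norm, norm_div, norm_pow,
      Real.norm_natCast]
    gcongr
    exact hC t (hsub t ht)
  · have h1 := (hasSum_diffQuot θ v (y t)).mul_left (e t)
    refine h1.congr_fun fun k => ?_
    rw [Finset.mul_sum]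
    exact Finset.sum_congr rfl fun i _ => by ring

end Deterministic

/-! ### Tail bounds, singly and for all monomials at once. -/

section Tails

variable {Ω : Type*} [MeasurableSpace Ω] {P : Measure Ω} [IsProbabilityMeasure P]

theorem measure_ge_le_of_hasSubgaussianMGF {X : Ω → ℝ} {c : NNReal} {W : ℝ}
    (h : ProbabilityTheory.HasSubgaussianMGF X c P) (hc : (c : ℝ) ≤ W) {a : ℝ} (ha : 0 ≤ a) :
    P {ω | a ≤ X ω} ≤ ENNReal.ofReal (Real.exp (-a ^ 2 / (2 * W))) := by
  have hW : 0 ≤ W := c.2.trans hc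
  have h' : ProbabilityTheory.HasSubgaussianMGF X W.toNNReal P := by
    refine ⟨h.integrable_exp_mul, fun t => (h.mgf_le t).trans (Real.exp_le_exp.2 ?_)⟩
    rw [Real.coe_toNNReal _ hW]
    gcongr
  have := h'.measure_ge_le ha
  rw [Real.coe_toNNReal _ hW] at this
  rw [← ofReal_measureReal]
  exact ENNReal.ofReal_le_ofReal this

theorem measure_abs_gt_le_of_hasSubgaussianMGF {X : Ω → ℝ} {c : NNReal} {W : ℝ}
    (h : ProbabilityTheory.HasSubgaussianMGF X c P) (hc : (c : ℝ) ≤ W) {a : ℝ} (ha : 0 ≤ a) :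
    P {ω | a < |X ω|} ≤ 2 * ENNReal.ofReal (Real.exp (-a ^ 2 / (2 * W))) := by
  have hsub : {ω | a < |X ω|} ⊆ {ω | a ≤ X ω} ∪ {ω | a ≤ (-X) ω} := fun ω hω => by
    rcases lt_abs.1 (show a < |X ω| from hω) with h1 | h1
    · exact Or.inl h1.le
    · exact Or.inr h1.le
  refine (measure_mono hsub).trans ((measure_union_le _ _).trans ?_)
  rw [two_mul]
  exact add_le_add (measure_ge_le_of_hasSubgaussianMGF h hc ha)
    (measure_ge_le_of_hasSubgaussianMGF h.neg hc ha)

variable {ε ξ : ℝ → Ω → ℝ} {ψ : ℝ → ℝ} {q : ℕ}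

/-- Simultaneous tail bound for the coordinates of the expansion of the noise functional. -/
theorem measure_iUnion_coordinate_gt_le (hε : IsCentredContinuousNoise P ε)
    (hξ : IsIntegratedWhiteNoise P ξ) (hψ : MemLp ψ 2 volume)
    (hεξ : ∀ t, IsMeanSquareIntegral P ξ (fun s => ψ (t - s)) (ε t))
    (hf : spectralSup ψ hψ < ⊤) {V : ℝ} (hV : 2 * Real.pi * (spectralSup ψ hψ).toReal ≤ V)
    (hV0 : 0 < V) {T : ℝ} (hT : 0 < T) {y : ℝ → EuclideanSpace ℝ (Fin q)}
    (hy : ContinuousOn y (Icc 0 T)) {θ : EuclideanSpace ℝ (Fin q)} {E C x : ℝ} (hE : 0 < E)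
    (hC : 0 < C) (hθE : ∀ t ∈ Icc 0 T, Real.exp (inner ℝ θ (y t)) ≤ E)
    (hyC : ∀ t ∈ Icc 0 T, ‖y t‖ ≤ C) (hx : 0 ≤ x) (hqx : q * Real.exp (-x ^ 2) ≤ 1 / 2) :
    P (⋃ k : ℕ, ⋃ i : Fin (k + 1) → Fin q, {ω | Real.sqrt (T * V) * x *
        ((k + 1) * (E * C ^ (k + 1))) < |∫ t in (0 : ℝ)..T,
          ε t ω * (Real.exp (inner ℝ θ (y t)) * monomial (y t) k i)|}) ≤
      ENNReal.ofReal (4 * q * Real.exp (-x ^ 2 / 2)) := by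
  -- The threshold exceeds the standard deviation scale by `x (k+1)`, so the tail decays like
  -- `exp(-x² (k+1)²/2)`, fast enough to beat the `q^(k+1)` monomials of that degree.
  have hterm : ∀ (k : ℕ) (i : Fin (k + 1) → Fin q), P {ω | Real.sqrt (T * V) * x *
        ((k + 1) * (E * C ^ (k + 1))) < |∫ t in (0 : ℝ)..T,
          ε t ω * (Real.exp (inner ℝ θ (y t)) * monomial (y t) k i)|} ≤
      ENNReal.ofReal (2 * Real.exp (-(x ^ 2 * (k + 1) ^ 2) / 2)) := by
    intro k i
    have hg : ContinuousOn (fun t => Real.exp (inner ℝ θ (y t)) * monomial (y t) k i)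
        (Icc 0 T) := by
      refine ContinuousOn.mul (by fun_prop) ?_
      unfold monomial
      exact continuousOn_finsetProd _ fun l _ =>
        (EuclideanSpace.proj (𝕜 := ℝ) (i l)).continuous.comp_continuousOn hy
    have h1 := hasSubgaussianMGF_integral_mul hε hξ hψ hεξ hf hV hT.le hg
    have h2 : ∫ t in (0 : ℝ)..T, (Real.exp (inner ℝ θ (y t)) * monomial (y t) k i) ^ 2 ≤
        T * (E * C ^ (k + 1)) ^ 2 := by
      have h3 : ∫ _t in (0 : ℝ)..T, (E * C ^ (k + 1)) ^ 2 = T * (E * C ^ (k + 1)) ^ 2 := by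
        simp
      rw [← h3]
      refine intervalIntegral.integral_mono_on hT.le
        (intervalIntegrable_of_continuousOn_Icc hT.le (hg.pow 2)) (by simp) fun t ht => ?_
      rw [← sq_abs, abs_mul, Real.abs_exp]
      gcongr
      · exact hθE t ht
      · exact abs_monomial_le (hyC t ht) k i
    have hI : 0 ≤ ∫ t in (0 : ℝ)..T, (Real.exp (inner ℝ θ (y t)) * monomial (y t) k i) ^ 2 :=
      intervalIntegral.integral_nonneg hT.le fun t _ => sq_nonneg _
    refine (measure_abs_gt_le_of_hasSubgaussianMGF h1
      (W := V * (T * (E * C ^ (k + 1)) ^ 2)) ?_ (by positivity)).trans_eq ?_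
    · rw [Real.coe_toNNReal _ (by positivity)]
      gcongr
    · rw [ENNReal.ofReal_mul (by norm_num), ENNReal.ofReal_ofNat]
      congr 3
      rw [mul_pow, mul_pow, Real.sq_sqrt (by positivity)]
      field_simp
  -- From `(k+1)² ≥ 1 + 2k`, each further degree contributes at most `q exp(-x²) ≤ 1/2`, and a
  -- geometric series remains.
  have hgeo : ∀ k : ℕ, (q : ℝ) ^ (k + 1) * (2 * Real.exp (-(x ^ 2 * (k + 1) ^ 2) / 2)) ≤
      2 * q * Real.exp (-x ^ 2 / 2) * (1 / 2) ^ k := by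
    intro k
    have h1 : Real.exp (-(x ^ 2 * (k + 1) ^ 2) / 2) ≤
        Real.exp (-x ^ 2 / 2) * Real.exp (-x ^ 2) ^ k := by
      rw [← Real.exp_nat_mul, ← Real.exp_add]
      refine Real.exp_le_exp.2 ?_
      nlinarith [mul_nonneg (sq_nonneg x) (sq_nonneg (k : ℝ))]
    calc _ ≤ (q : ℝ) ^ (k + 1) * (2 * (Real.exp (-x ^ 2 / 2) * Real.exp (-x ^ 2) ^ k)) := by
          gcongr
      _ = 2 * q * Real.exp (-x ^ 2 / 2) * (q * Real.exp (-x ^ 2)) ^ k := by ring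
      _ ≤ _ := by gcongr
  calc _ ≤ ∑' k : ℕ, ∑' i : Fin (k + 1) → Fin q, P {ω | Real.sqrt (T * V) * x *
        ((k + 1) * (E * C ^ (k + 1))) < |∫ t in (0 : ℝ)..T,
          ε t ω * (Real.exp (inner ℝ θ (y t)) * monomial (y t) k i)|} :=
        (measure_iUnion_le _).trans (ENNReal.tsum_le_tsum fun k => measure_iUnion_le _)
    _ ≤ ∑' k : ℕ, ENNReal.ofReal (2 * q * Real.exp (-x ^ 2 / 2) * (1 / 2) ^ k) := by
        refine ENNReal.tsum_le_tsum fun k => ?_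
        rw [tsum_fintype]
        refine (Finset.sum_le_sum fun i _ => hterm k i).trans ?_
        refine le_trans (le_of_eq ?_) (ENNReal.ofReal_le_ofReal (hgeo k))
        rw [ENNReal.ofReal_mul (by positivity : (0 : ℝ) ≤ (q : ℝ) ^ (k + 1)),
          ENNReal.ofReal_pow (by positivity)]
        simp
    _ = _ := by
        rw [← ENNReal.ofReal_tsum_of_nonneg (fun k => by positivity)
          (summable_geometric_two.mul_left _), tsum_mul_left, tsum_geometric_two]
        congr 1
        ring

end Tails

/-! ### Finite partition of directions and stability of the signal. -/

section Cover

variable {q : ℕ}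

/-- The direction `v/‖v‖` is kept as a separate coordinate because it is discontinuous at `0`. The
pair stays in a compact ball, so finitely many cells suffice. -/
theorem exists_finite_cells (q : ℕ) (D : ℝ) {δ : ℝ} (hδ : 0 < δ) :
    ∃ (t : Finset (EuclideanSpace ℝ (Fin q) × EuclideanSpace ℝ (Fin q)))
      (cell : EuclideanSpace ℝ (Fin q) → EuclideanSpace ℝ (Fin q) × EuclideanSpace ℝ (Fin q)),
      (∀ v, ‖v‖ ≤ D → cell v ∈ t) ∧ ∀ v w, ‖v‖ ≤ D → ‖w‖ ≤ D → cell v = cell w →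
        ‖‖v‖⁻¹ • v - ‖w‖⁻¹ • w‖ ≤ δ ∧ ‖v - w‖ ≤ δ := by
  classical
  have hc : IsCompact (Metric.closedBall (0 : EuclideanSpace ℝ (Fin q) ×
    EuclideanSpace ℝ (Fin q)) (max 1 D)) := isCompact_closedBall _ _
  obtain ⟨t, -, htf, ht⟩ := hc.finite_cover_balls (half_pos hδ)
  have hex : ∀ v : EuclideanSpace ℝ (Fin q), ‖v‖ ≤ D → ∃ c ∈ t,
      dist (‖v‖⁻¹ • v, v) c < δ / 2 := by
    intro v hv
    have hmem : (‖v‖⁻¹ • v, v) ∈ Metric.closedBall (0 : EuclideanSpace ℝ (Fin q) ×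
        EuclideanSpace ℝ (Fin q)) (max 1 D) := by
      rw [mem_closedBall_zero_iff, Prod.norm_def]
      refine max_le_max ?_ hv
      rw [norm_smul, norm_inv, norm_norm]
      exact inv_mul_le_one
    simpa using ht hmem
  refine ⟨htf.toFinset, fun v => if h : ‖v‖ ≤ D then (hex v h).choose else 0, fun v hv => ?_,
    fun v w hv hw hvw => ?_⟩
  · simp only [hv, dif_pos, Finite.mem_toFinset]
    exact (hex v hv).choose_spec.1
  · simp only [hv, hw, dif_pos] at hvw
    have h1 := (hex v hv).choose_spec.2
    have h2 := (hex w hw).choose_spec.2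
    rw [hvw] at h1
    have h3 := (dist_triangle_right (‖v‖⁻¹ • v, v) (‖w‖⁻¹ • w, w) _).trans_lt (add_lt_add h1 h2)
    rw [add_halves, Prod.dist_eq, max_lt_iff, dist_eq_norm, dist_eq_norm] at h3
    exact ⟨h3.1.le, h3.2.le⟩

theorem integral_diffQuot_sq_ge {y : ℝ → EuclideanSpace ℝ (Fin q)} {T : ℝ} (hT : 0 ≤ T)
    (hy : ContinuousOn y (Icc 0 T)) {θ v w : EuclideanSpace ℝ (Fin q)} {κ : ℝ}
    (h : ∀ t ∈ Icc 0 T, |diffQuot θ v (y t) - diffQuot θ w (y t)| ≤ κ) :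
    15 / 16 * (∫ t in (0 : ℝ)..T, diffQuot θ w (y t) ^ 2) - T * (16 * κ ^ 2) ≤
      ∫ t in (0 : ℝ)..T, diffQuot θ v (y t) ^ 2 := by
  have hi : ∀ u, IntervalIntegrable (fun t => diffQuot θ u (y t) ^ 2) volume 0 T := fun u =>
    intervalIntegrable_of_continuousOn_Icc hT ((continuousOn_diffQuot hy θ u).pow 2)
  have h1 : ∫ t in (0 : ℝ)..T, (15 / 16 * diffQuot θ w (y t) ^ 2 - 16 * κ ^ 2) =
      15 / 16 * (∫ t in (0 : ℝ)..T, diffQuot θ w (y t) ^ 2) - T * (16 * κ ^ 2) := by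
    rw [intervalIntegral.integral_sub ((hi w).const_mul _) (by simp),
      intervalIntegral.integral_const_mul]
    simp
    ring
  rw [← h1]
  refine intervalIntegral.integral_mono_on hT (((hi w).const_mul _).sub (by simp)) (hi v)
    fun t ht => ?_
  have h2 := pow_le_pow_left₀ (abs_nonneg _) (h t ht) 2
  rw [sq_abs] at h2
  -- With `a`, `b` the two quotients, `a² - 15/16 b² + 16 (a-b)² = (16a - 15b)²/16 + (a-b)²`.
  nlinarith [sq_nonneg (16 * diffQuot θ v (y t) - 15 * diffQuot θ w (y t)),
    sq_nonneg (diffQuot θ v (y t) - diffQuot θ w (y t))]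

end Cover

/-! ### From fixed directions to the estimator. -/

section LeastSquares

variable {Ω : Type*} [MeasurableSpace Ω] {P : Measure Ω} [IsProbabilityMeasure P]
  {ε ξ : ℝ → Ω → ℝ} {ψ : ℝ → ℝ} {q : ℕ}

/-- Exponential bound at a fixed direction. -/
theorem measure_integral_diffQuot_ge_le (hε : IsCentredContinuousNoise P ε)
    (hξ : IsIntegratedWhiteNoise P ξ) (hψ : MemLp ψ 2 volume)
    (hεξ : ∀ t, IsMeanSquareIntegral P ξ (fun s => ψ (t - s)) (ε t))
    (hf : spectralSup ψ hψ < ⊤) {V : ℝ} (hV : 2 * Real.pi * (spectralSup ψ hψ).toReal ≤ V)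
    (hV0 : 0 < V) {T : ℝ} (hT : 0 < T) {y : ℝ → EuclideanSpace ℝ (Fin q)}
    (hy : ContinuousOn y (Icc 0 T)) {θ w : EuclideanSpace ℝ (Fin q)} {m R : ℝ} (hm : 0 < m)
    (hR : 0 ≤ R) (hI : T * m ≤ ∫ t in (0 : ℝ)..T, diffQuot θ w (y t) ^ 2) :
    P {ω | 7 / 8 * R * (∫ t in (0 : ℝ)..T, diffQuot θ w (y t) ^ 2) ≤
        2 * Real.sqrt T * ∫ t in (0 : ℝ)..T, ε t ω * diffQuot θ w (y t)} ≤
      ENNReal.ofReal (Real.exp (-(49 / 512 * m / V) * R ^ 2)) := by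
  set I := ∫ t in (0 : ℝ)..T, diffQuot θ w (y t) ^ 2 with hIdef
  have hI0 : 0 < I := lt_of_lt_of_le (by positivity) hI
  have hs : 0 < Real.sqrt T := Real.sqrt_pos.2 hT
  have h1 := hasSubgaussianMGF_integral_mul hε hξ hψ hεξ hf hV hT.le
    (continuousOn_diffQuot hy θ w)
  have h2 := measure_ge_le_of_hasSubgaussianMGF h1
    (Real.coe_toNNReal _ (by positivity)).le
    -- Chernoff with proxy `V I` gives the exponent `(7/16)² R² I / (2 T V)`, which is where
    -- `49/512` comes from; then `I / T ≥ m`.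
    (a := 7 / 16 * R * I / Real.sqrt T) (by positivity)
  refine le_trans (measure_mono fun ω hω => ?_) (h2.trans (ENNReal.ofReal_le_ofReal
    (Real.exp_le_exp.2 ?_)))
  · rw [mem_ofPred_eq] at hω ⊢
    rw [div_le_iff₀ hs]
    linarith
  · rw [← hIdef, div_pow, Real.sq_sqrt hT.le]
    have h3 : -((7 / 16 * R * I) ^ 2 / T) / (2 * (V * I)) = -(49 / 512 * (I / T) / V) * R ^ 2 := by
      field_simp
      ring
    rw [h3, neg_mul, neg_mul, neg_le_neg_iff]
    gcongr
    rw [le_div_iff₀ hT]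
    linarith

/-- If the error is large and no monomial functional is exceptional, the basic inequality at `v`
transfers, slightly weakened, to the representative of the cell of `v`. A union over the finitely
many cells concludes. -/
theorem measure_lse_le (hε : IsCentredContinuousNoise P ε)
    (hξ : IsIntegratedWhiteNoise P ξ) (hψ : MemLp ψ 2 volume)
    (hεξ : ∀ t, IsMeanSquareIntegral P ξ (fun s => ψ (t - s)) (ε t))
    (hf : spectralSup ψ hψ < ⊤) {V : ℝ} (hV : 2 * Real.pi * (spectralSup ψ hψ).toReal ≤ V)
    (hV0 : 0 < V) {T : ℝ} (hT : 0 < T) {y : ℝ → EuclideanSpace ℝ (Fin q)}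
    (hy : ContinuousOn y (Icc 0 T)) {θ : EuclideanSpace ℝ (Fin q)} {E C : ℝ} (hE : 0 < E)
    (hC : 0 < C) (hθE : ∀ t ∈ Icc 0 T, Real.exp (inner ℝ θ (y t)) ≤ E)
    (hyC : ∀ t ∈ Icc 0 T, ‖y t‖ ≤ C) {Θ : Set (EuclideanSpace ℝ (Fin q))} (hθ : θ ∈ Θ)
    {D : ℝ} (hD : 1 ≤ D) (hΘD : ∀ τ ∈ closure Θ, ‖τ - θ‖ ≤ D) {m : ℝ} (hm : 0 < m)
    (hI : ∀ v, v ≠ 0 → θ + v ∈ closure Θ →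
      T * m ≤ ∫ t in (0 : ℝ)..T, diffQuot θ v (y t) ^ 2)
    {K R δ : ℝ} (hR : 0 < R) (hK : 0 ≤ K)
    (hqx : q * Real.exp (-(K * R) ^ 2) ≤ 1 / 2)
    (hδm : 16 * (δ * ∑' k, incrWeight q D E C k) ^ 2 +
      2 * (δ * Real.sqrt V * K * ∑' k, incrWeight q D E C k) ≤ m / 16)
    {t : Finset (EuclideanSpace ℝ (Fin q) × EuclideanSpace ℝ (Fin q))}
    {cell : EuclideanSpace ℝ (Fin q) → EuclideanSpace ℝ (Fin q) × EuclideanSpace ℝ (Fin q)}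
    (hcell : ∀ v, ‖v‖ ≤ D → cell v ∈ t)
    (hcell2 : ∀ v w, ‖v‖ ≤ D → ‖w‖ ≤ D → cell v = cell w →
        ‖‖v‖⁻¹ • v - ‖w‖⁻¹ • w‖ ≤ δ ∧ ‖v - w‖ ≤ δ)
    {est : Ω → EuclideanSpace ℝ (Fin q)}
    (hest : IsLSE P Θ (expRegression y) (fun t ω => expRegression y t θ + ε t ω) T est) :
    P {ω | R ≤ ‖Real.sqrt T • (est ω - θ)‖} ≤
      ENNReal.ofReal (4 * q * Real.exp (-(K * R) ^ 2 / 2)) +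
        t.card * ENNReal.ofReal (Real.exp (-(49 / 512 * m / V) * R ^ 2)) := by
  classical
  set A := ∑' k, incrWeight q D E C k with hA
  have hs : 0 < Real.sqrt T := Real.sqrt_pos.2 hT
  set bad : Set Ω := ⋃ k : ℕ, ⋃ i : Fin (k + 1) → Fin q, {ω | Real.sqrt (T * V) * (K * R) *
        ((k + 1) * (E * C ^ (k + 1))) < |∫ t in (0 : ℝ)..T,
          ε t ω * (Real.exp (inner ℝ θ (y t)) * monomial (y t) k i)|} with hbad
  have hPbad : P bad ≤ ENNReal.ofReal (4 * q * Real.exp (-(K * R) ^ 2 / 2)) :=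
    measure_iUnion_coordinate_gt_le hε hξ hψ hεξ hf hV hV0 hT hy hE hC hθE hyC
      (by positivity) hqx
  let F : EuclideanSpace ℝ (Fin q) → Set Ω := fun w =>
    {ω | 7 / 8 * R * (∫ t in (0 : ℝ)..T, diffQuot θ w (y t) ^ 2) ≤
        2 * Real.sqrt T * ∫ t in (0 : ℝ)..T, ε t ω * diffQuot θ w (y t)}
  -- Representatives must be admissible directions for the lower bound `hI` to hold; cells without
  -- one contribute nothing.
  let G : EuclideanSpace ℝ (Fin q) × EuclideanSpace ℝ (Fin q) → Set Ω := fun c =>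
    if h : ∃ w, (w ≠ 0 ∧ θ + w ∈ closure Θ) ∧ cell w = c then F h.choose else ∅
  have hPG : ∀ c, P (G c) ≤ ENNReal.ofReal (Real.exp (-(49 / 512 * m / V) * R ^ 2)) := by
    intro c
    by_cases h : ∃ w, (w ≠ 0 ∧ θ + w ∈ closure Θ) ∧ cell w = c
    · simp only [G, h, dif_pos]
      exact measure_integral_diffQuot_ge_le hε hξ hψ hεξ hf hV hV0 hT hy hm hR.le
        (hI _ h.choose_spec.1.1 h.choose_spec.1.2)
    · simp [G, h]
  have hsub : {ω | R ≤ ‖Real.sqrt T • (est ω - θ)‖} ≤ᵐ[P] (bad ∪ ⋃ c ∈ t, G c : Set Ω) := by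
    filter_upwards [hε.ae_continuous, hest.ae_mem, hest.ae_isMinOn] with ω hc hmem hmin hω
    by_cases hωb : ω ∈ bad
    · exact Or.inl hωb
    right
    have hω' : R ≤ ‖Real.sqrt T • (est ω - θ)‖ := hω
    rw [norm_smul, Real.norm_of_nonneg hs.le] at hω'
    set v := est ω - θ with hv
    have hv0 : v ≠ 0 := fun h0 => by
      rw [h0, norm_zero, mul_zero] at hω'
      linarith
    have hθv : θ + v = est ω := by rw [hv]; abel
    have hvK : v ≠ 0 ∧ θ + v ∈ closure Θ := ⟨hv0, by rwa [hθv]⟩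
    have hvD : ‖v‖ ≤ D := hΘD _ hmem
    have hex : ∃ w, (w ≠ 0 ∧ θ + w ∈ closure Θ) ∧ cell w = cell v := ⟨v, hvK, rfl⟩
    refine mem_iUnion₂.2 ⟨cell v, hcell v hvD, ?_⟩
    simp only [G, hex, dif_pos]
    obtain ⟨⟨-, hwΘ⟩, hwc⟩ := hex.choose_spec
    have hw0 := hex.choose_spec.1.1
    set w := hex.choose
    have hwD : ‖w‖ ≤ D := by simpa using hΘD _ hwΘ
    obtain ⟨hd1, hd2⟩ := hcell2 v w hvD hwD hwc.symm
    have hcoef := abs_coef_sub_le hD hvD hwD hd1 hd2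
    have he : ContinuousOn (fun t => ε t ω) (Icc 0 T) := hc.continuousOn
    have hbasic : ‖v‖ * ∫ t in (0 : ℝ)..T, diffQuot θ v (y t) ^ 2 ≤
        2 * ∫ t in (0 : ℝ)..T, ε t ω * diffQuot θ v (y t) := by
      refine norm_mul_integral_sq_le_of_lsFunctional_le hT.le hy he hv0 ?_
      rw [hθv]
      exact isMinOn_iff.1 hmin θ (subset_closure hθ)
    have hnoise : |(∫ t in (0 : ℝ)..T, ε t ω * diffQuot θ v (y t)) -
        ∫ t in (0 : ℝ)..T, ε t ω * diffQuot θ w (y t)| ≤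
        δ * (Real.sqrt (T * V) * (K * R)) * A := by
      refine abs_sub_le_of_hasSum (hasSum_integral_mul_diffQuot hT.le hy he θ v)
        (hasSum_integral_mul_diffQuot hT.le hy he θ w) hcoef fun k i => ?_
      by_contra! hlt
      exact hωb (mem_iUnion₂.2 ⟨k, i, hlt⟩)
    have hquot : ∀ t ∈ Icc 0 T, |diffQuot θ v (y t) - diffQuot θ w (y t)| ≤ δ * A := by
      intro t ht
      have := abs_sub_le_of_hasSum (b := 1) (E := E) (C := C) (hasSum_diffQuot θ v (y t))
        (hasSum_diffQuot θ w (y t)) hcoef fun k i => ?_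
      · simpa using this
      · rw [abs_mul, Real.abs_exp, one_mul]
        have h1 : Real.exp (inner ℝ θ (y t)) * |monomial (y t) k i| ≤ E * C ^ (k + 1) :=
          mul_le_mul (hθE t ht) (abs_monomial_le (hyC t ht) k i) (abs_nonneg _) hE.le
        refine h1.trans (le_mul_of_one_le_left (by positivity) ?_)
        have : (0 : ℝ) ≤ k := k.cast_nonneg
        linarith
    have hIvw := integral_diffQuot_sq_ge hT.le hy hquot
    have hIw := hI w hw0 hwΘ
    have hIv := hI v hv0 hvK.2
    rw [Real.sqrt_mul hT.le] at hnoise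
    change 7 / 8 * R * (∫ t in (0 : ℝ)..T, diffQuot θ w (y t) ^ 2) ≤
        2 * Real.sqrt T * ∫ t in (0 : ℝ)..T, ε t ω * diffQuot θ w (y t)
    generalize (∫ t in (0 : ℝ)..T, ε t ω * diffQuot θ w (y t)) = ηw at *
    generalize (∫ t in (0 : ℝ)..T, ε t ω * diffQuot θ v (y t)) = ηv at *
    generalize (∫ t in (0 : ℝ)..T, diffQuot θ w (y t) ^ 2) = Iw at *
    generalize (∫ t in (0 : ℝ)..T, diffQuot θ v (y t) ^ 2) = Iv at *
    have hIv0 : 0 ≤ Iv := le_trans (by positivity) hIv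
    have e1 : R * Iv ≤ 2 * Real.sqrt T * ηv := by
      have h1 := mul_le_mul_of_nonneg_right hω' hIv0
      have h2 := mul_le_mul_of_nonneg_left hbasic hs.le
      linarith
    -- The noise oscillation carries `√T`, so after multiplication by `√T` the loss is of order `R T
    -- δ`, the same order in `R` and `T` as the signal term. This is why `δ` can be fixed once.
    have e2 : 2 * Real.sqrt T * ηv - R * (T * (2 * (δ * Real.sqrt V * K * A))) ≤
        2 * Real.sqrt T * ηw := by
      have h1 := (abs_le.1 hnoise).2
      have h2 : 2 * Real.sqrt T * (ηv - ηw) ≤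
          2 * Real.sqrt T * (δ * (Real.sqrt T * Real.sqrt V * (K * R)) * A) := by gcongr
      have h3 : 2 * Real.sqrt T * (δ * (Real.sqrt T * Real.sqrt V * (K * R)) * A) =
          R * ((Real.sqrt T * Real.sqrt T) * (2 * (δ * Real.sqrt V * K * A))) := by ring
      rw [h3, Real.mul_self_sqrt hT.le] at h2
      linarith
    -- One sixteenth of `Iw` is lost in comparing the squares, and `hδm` bounds the remaining losses
    -- by `T m / 16 ≤ Iw / 16`.
    have e3 : 7 / 8 * Iw ≤ Iv - T * (2 * (δ * Real.sqrt V * K * A)) := by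
      have h1 := mul_le_mul_of_nonneg_left hδm hT.le
      linarith
    have e4 := mul_le_mul_of_nonneg_left e3 hR.le
    linarith
  calc P {ω | R ≤ ‖Real.sqrt T • (est ω - θ)‖} ≤ P (bad ∪ ⋃ c ∈ t, G c) := measure_mono_ae hsub
    _ ≤ P bad + P (⋃ c ∈ t, G c) := measure_union_le _ _
    _ ≤ P bad + ∑ c ∈ t, P (G c) := by gcongr; exact measure_biUnion_finset_le _ _
    _ ≤ _ := by
        refine add_le_add hPbad ((Finset.sum_le_sum fun c _ => hPG c).trans_eq ?_)
        rw [Finset.sum_const, nsmul_eq_mul]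

end LeastSquares

end SubGaussianRegression

/-! ### Choice of constants and conclusion. -/

open SubGaussianRegression in
theorem mainTheorem9
    {Ω : Type*} [MeasurableSpace Ω] (P : Measure Ω) [IsProbabilityMeasure P]
    (q : ℕ) (hq : 1 ≤ q)
    -- the parameter set
    (Θ : Set (EuclideanSpace ℝ (Fin q)))
    (hΘo : IsOpen Θ) (hΘb : Bornology.IsBounded Θ) (hΘc : Convex ℝ Θ)
    -- the noise: centred and continuous, in mean square and almost surely
    (ε : ℝ → Ω → ℝ) (hε : IsCentredContinuousNoise P ε)
    -- the noise is a moving average `ε(t) = ∫ ψ(t - s) dξ(s)`, with bounded spectral density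
    (ξ : ℝ → Ω → ℝ) (hξ : IsIntegratedWhiteNoise P ξ)
    (ψ : ℝ → ℝ) (hψ₀ : ∀ t < 0, ψ t = 0) (hψ : MemLp ψ 2 volume)
    (hεξ : ∀ t, IsMeanSquareIntegral P ξ (fun s => ψ (t - s)) (ε t))
    (hf₀ : spectralSup ψ hψ < ⊤)
    -- the regressors
    (Y : Set (EuclideanSpace ℝ (Fin q))) (hY : IsCompact Y)
    (y : ℝ → EuclideanSpace ℝ (Fin q)) (hy : ContinuousOn y (Ici 0)) (hyY : ∀ t, 0 ≤ t → y t ∈ Y)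
    (J : Matrix (Fin q) (Fin q) ℝ) (hJ : J.PosDef)
    (hJlim : Tendsto (gramAverage y) atTop (𝓝 J)) :
    ∃ T₀ > 0, ∃ R₀ > 0, ∀ β > 0, ∃ B > 0, ∃ b > 0,
      b ≥ (minExp Y Θ) ^ 2 * leastEigenvalue J hJ.isHermitian /
            (16 * Real.pi * (spectralSup ψ hψ).toReal * (1 + q)) - β ∧
      ∀ θ ∈ Θ, ∀ T > T₀, ∀ est : Ω → EuclideanSpace ℝ (Fin q),
        IsLSE P Θ (expRegression y) (fun t ω => expRegression y t θ + ε t ω) T est →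
        ∀ R > R₀,
          P.real {ω | R ≤ ‖Real.sqrt T • (est ω - θ)‖} ≤ B * Real.exp (-b * R ^ 2) := by
  obtain ⟨CY, hCY⟩ := hY.exists_bound_of_continuousOn continuousOn_id
  obtain ⟨CΘ, hCΘ⟩ := hΘb.closure.exists_norm_le
  have hyI : ∀ T, ContinuousOn y (Icc 0 T) := fun T => hy.mono Icc_subset_Ici_self
  rcases Θ.eq_empty_or_nonempty with rfl | hΘn
  -- For empty `Θ` the infimum defining `minExp` is taken over the empty set and equals `0`, and no
  -- `θ` has to be treated.
  · refine ⟨1, one_pos, 1, one_pos, fun β hβ => ⟨1, one_pos, 1, one_pos, ?_, by simp⟩⟩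
    have : minExp Y (∅ : Set (EuclideanSpace ℝ (Fin q))) = 0 := by simp [minExp]
    rw [this]
    simp only [ne_eq, OfNat.ofNat_ne_zero, not_false_eq_true, zero_pow, zero_mul, zero_div]
    linarith
  set L := minExp Y Θ
  set lam := leastEigenvalue J hJ.isHermitian
  set f₀ := (spectralSup ψ hψ).toReal
  have hf₀nn : 0 ≤ f₀ := ENNReal.toReal_nonneg
  have hLpos : 0 < L := minExp_pos hCY hCΘ ⟨y 0, hyY 0 le_rfl⟩ hΘn
  have hlampos : 0 < lam := leastEigenvalue_pos hq hJ
  have hqR : (1 : ℝ) ≤ q := by exact_mod_cast hq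
  -- When `f₀ = 0` any positive proxy will do, since the required lower bound on `b` is then `-β`.
  obtain ⟨V, hV0, hV, hVf⟩ : ∃ V > 0, 2 * Real.pi * f₀ ≤ V ∧ (f₀ ≠ 0 → V = 2 * Real.pi * f₀) := by
    rcases hf₀nn.eq_or_lt with h | h
    · exact ⟨1, one_pos, by simp [← h], fun h' => absurd h.symm h'⟩
    · exact ⟨2 * Real.pi * f₀, by positivity, le_rfl, fun _ => rfl⟩
  obtain ⟨T₀, hT₀, hgram⟩ := exists_forall_le_integral_inner_sq hq hy hJ hJlim
  set m := L ^ 2 * (7 / 8 * lam) with hm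
  have hmpos : 0 < m := by positivity
  set b := 49 / 512 * m / V with hb
  have hbpos : 0 < b := by positivity
  -- With `K² = 2b` the exceptional event has probability of order `exp(-b R²)`, the same rate as
  -- the cells.
  set K := Real.sqrt (2 * b) with hK
  have hK2 : K ^ 2 = 2 * b := Real.sq_sqrt (by positivity)
  set C := max CY 1
  have hCpos : 0 < C := lt_of_lt_of_le one_pos (le_max_right _ _)
  set D := max (2 * CΘ) 1
  set E := Real.exp (CΘ * C)
  set A := ∑' k, incrWeight q D E C k
  obtain ⟨δ, hδpos, hδm⟩ : ∃ δ > 0, 16 * (δ * A) ^ 2 + 2 * (δ * Real.sqrt V * K * A) ≤ m / 16 := by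
    have h1 : Tendsto (fun δ : ℝ => 16 * (δ * A) ^ 2 + 2 * (δ * Real.sqrt V * K * A)) (𝓝[>] 0)
        (𝓝 0) := by
      refine (Continuous.tendsto' (by fun_prop) 0 0 (by simp)).mono_left nhdsWithin_le_nhds
    obtain ⟨δ, h2, h3⟩ := ((h1.eventually_le_const (by positivity : 0 < m / 16)).and
      self_mem_nhdsWithin).exists
    exact ⟨δ, h3, h2⟩
  obtain ⟨t, cell, hcell, hcell2⟩ := exists_finite_cells q D hδpos
  -- Beyond this radius `q exp(-(K R)²) ≤ 1/2`, the condition for the geometric series over degrees.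
  -- The prefactor is `4q` from the exceptional event plus one for each cell.
  refine ⟨T₀, hT₀, Real.sqrt (Real.log (2 * q) / (2 * b)) + 1, by positivity, fun β hβ =>
    ⟨4 * q + t.card, by positivity, b, hbpos, ?_, fun θ hθ T hT est hest R hR => ?_⟩⟩
  -- In units of `L² lam / (2π f₀)` the required value is at most `1/16 = 256/4096`, as `1 + q ≥ 2`,
  -- while `b = 49/512 · 7/8 = 343/4096`. The bound thus holds even without subtracting `β`.
  · suffices h : L ^ 2 * lam / (16 * Real.pi * f₀ * (1 + q)) ≤ b by linarith
    by_cases h0 : f₀ = 0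
    · simpa [h0] using hbpos.le
    · have hf₀pos : 0 < f₀ := lt_of_le_of_ne hf₀nn (Ne.symm h0)
      rw [hb, hVf h0, hm]
      have h1 : L ^ 2 * lam / (16 * Real.pi * f₀ * (1 + q)) ≤
          L ^ 2 * lam / (16 * Real.pi * f₀ * 2) := by
        gcongr
        linarith
      have h2 : L ^ 2 * lam / (16 * Real.pi * f₀ * 2) =
          1 / 16 * (L ^ 2 * lam / (2 * Real.pi * f₀)) := by
        field_simp
      have h3 : 49 / 512 * (L ^ 2 * (7 / 8 * lam)) / (2 * Real.pi * f₀) =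
          343 / 4096 * (L ^ 2 * lam / (2 * Real.pi * f₀)) := by
        field_simp
        norm_num
      have h4 : 0 ≤ L ^ 2 * lam / (2 * Real.pi * f₀) := by positivity
      rw [h3]
      linarith
  have hTpos : 0 < T := hT₀.trans hT
  have hRpos : 0 < R := lt_of_le_of_lt (by positivity) hR
  have hyC : ∀ t ∈ Icc 0 T, ‖y t‖ ≤ C := fun t ht =>
    (hCY _ (hyY t ht.1)).trans (le_max_left _ _)
  have hθE : ∀ t ∈ Icc 0 T, Real.exp (inner ℝ θ (y t)) ≤ E := fun t ht => by
    have h1 := hCΘ θ (subset_closure hθ)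
    refine Real.exp_le_exp.2 ((real_inner_le_norm _ _).trans ?_)
    exact mul_le_mul h1 (hyC t ht) (norm_nonneg _) ((norm_nonneg _).trans h1)
  have hΘD : ∀ τ ∈ closure Θ, ‖τ - θ‖ ≤ D := fun τ hτ => by
    have h1 := hCΘ θ (subset_closure hθ)
    have h2 := hCΘ τ hτ
    exact (norm_sub_le _ _).trans ((by linarith : ‖τ‖ + ‖θ‖ ≤ 2 * CΘ).trans (le_max_left _ _))
  have hI : ∀ v, v ≠ 0 → θ + v ∈ closure Θ →
      T * m ≤ ∫ t in (0 : ℝ)..T, diffQuot θ v (y t) ^ 2 := fun v hv hθv =>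
    le_integral_diffQuot_sq hTpos.le (hyI T) hv hLpos.le
      (fun t ht => minExp_le (hyY t ht.1) (subset_closure hθ))
      (fun t ht => minExp_le (hyY t ht.1) hθv) (hgram T hT v)
  have hqx : q * Real.exp (-(K * R) ^ 2) ≤ 1 / 2 := by
    have h1 : Real.log (2 * q) / (2 * b) ≤ R ^ 2 := by
      refine (Real.sqrt_le_left hRpos.le).1 ?_
      linarith
    rw [div_le_iff₀ (by positivity)] at h1
    have h2 : Real.exp (-(K * R) ^ 2) ≤ Real.exp (-Real.log (2 * q)) := by
      refine Real.exp_le_exp.2 ?_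
      rw [mul_pow, hK2]
      linarith
    rw [Real.exp_neg (Real.log _), Real.exp_log (by positivity)] at h2
    calc q * Real.exp (-(K * R) ^ 2) ≤ q * (2 * (q : ℝ))⁻¹ := by gcongr
      _ = 1 / 2 := by field_simp
  have hmain := measure_lse_le hε hξ hψ hεξ hf₀ hV hV0 hTpos (hyI T) (Real.exp_pos _) hCpos hθE
    hyC hθ (le_max_right _ _) hΘD hmpos hI hRpos (Real.sqrt_nonneg _) hqx hδm hcell hcell2 hest
  have hexp : -(K * R) ^ 2 / 2 = -b * R ^ 2 := by
    rw [mul_pow, hK2]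
    ring
  rw [hexp, ← hb, ← ENNReal.ofReal_natCast, ← ENNReal.ofReal_mul (by positivity),
    ← ENNReal.ofReal_add (by positivity) (by positivity), ← add_mul] at hmain
  exact ENNReal.toReal_le_of_le_ofReal (by positivity) hmain
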